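/- Let $\mathbb F$ be a field of characteristic zero. On $\mathbb F^3$ with coordinates $x,y,z$ put $\Theta^0_0=z\,\partial_y-y\,\partial_z$, $E=x\,\partial_x+\tfrac12 y\,\partial_y+\tfrac12 z\,\partial_z$, $E^l_k=x^l(y^2+z^2)^{k-l}E$ for $0\le l\le k$, and let $\mathscr E$ be the space of all formal sums $\sum\beta^l_kE^l_k$ over $0\le l\le k$, $l+k\ge1$. Grade it by $\delta(E^l_k)=2k-l$, $\delta(\Theta^0_0)=0$; $\mathscr E_n$ is the homogeneous part of grade $n$ and $v_n$ the grade-$n$ part of $v\in\Theta^0_0+\mathscr E$. A permissible (near-identity, quasi-Eulerian structure preserving) transformation is the time-one flow of some $S\in\mathscr E$. For $v\in\Theta^0_0+\mathscr E$ and $1\le k\le n$, the level-$k$ state map is $$d^{n,k}(Y_n,\dots,Y_{n-k+1})=\sum_{i=0}^{k-1}[Y_{n-i},v_i],\qquad Y_j\in\mathscr E_j,$$ defined for $k\ge2$ on the tuples with $(Y_{n-1},\dots,Y_{n-k+1})\in\ker d^{n-1,k-1}$; for $k>n$, $d^{n,k}:=d^{n,n}$. The vector field $v$ is in $k$-th level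 extended partial normal form if for all $n\ge1$, $v_n$ lies in a complement of $\operatorname{im}d^{n,k}$ in $\mathscr E_n$ that is spanned by some of the monomials $E^l_m$ of grade $n$; it is in infinite level (simplest) normal form if this holds for all $n\ge 1$ with $k=n$. **Theorem.** Let $v=\Theta^0_0+\sum_{0\le l\le k,\ l+k\ge1}\beta^l_kE^l_k$ with $\beta^1_1\ne0$, and put $$\varepsilon=\frac{\beta^0_1(\beta^1_1\beta^1_2-\beta^0_1\beta^2_2)}{(\beta^1_1)^2}.$$ There exist a natural number $r$, scalars $b_r$ and $b_k$ $(k\ge r+2)$ in $\mathbb F$, and a permissible transformation sending $v$ into a vector field $w$ of one of the two forms $$w=\Theta^0_0+\beta^1_1E^1_1+\beta^0_1E^0_1+\beta^2_2E^2_2+\beta^1_2E^1_2+b_rE^0_r+\sum_{k\ge r+2}b_kE^0_k\qquad(r\ge2),$$ $$w=\Theta^0_0+\beta^1_1E^1_1+\beta^0_1E^0_1+\beta^2_2E^2_2+\beta^1_2E^1_2+\varepsilon E^0_2+b_rE^0_r+\sum_{k\ge r+2}b_kE^0_k\qquad(\varepsilon\ne0,\ r>2),$$ where $\beta^1_1,\beta^0_1,\beta^2_2,\beta^1_2$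 are the coefficients of $v$. Here $r=2$ if $\beta^0_2\neq\varepsilon$; and if $\beta^0_2=\varepsilon$, then $r>2$ and $b_r\ne0$ unless $b_r$ and all $b_k$ $(k\ge r+2)$ vanish. The vector field $w$ is in $(2r+2)$-th level extended partial normal form and already in infinite level normal form. Finally, if $b_r\neq0$, then $w$ has no non-trivial symmetry: every $S\in\mathscr E$ with $[S,w]=0$ is a scalar multiple of $w-\Theta^0_0$, and every permissible transformation that leaves $w$ invariant is the time-one flow of a scalar multiple of $w-\Theta^0_0$. -/

import Mathlib

noncomputable section

namespace HopfZero

/-- Formal vector fields on `F³`: the triple `(v₀, v₁, v₂)` of formal power series in the variables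
`x = X 0`, `y = X 1`, `z = X 2` stands for `v₀ ∂/∂x + v₁ ∂/∂y + v₂ ∂/∂z`. -/
abbrev VF (F : Type*) [Field F] := Fin 3 → MvPowerSeries (Fin 3) F

variable {F : Type*} [Field F]

open MvPowerSeries

/-- The action of a formal vector field on formal functions, `v(h) = ∑ⱼ vⱼ ∂h/∂xⱼ`. -/
def act (v : VF F) (h : MvPowerSeries (Fin 3) F) : MvPowerSeries (Fin 3) F :=
  ∑ j, v j * pderiv F j h

/-- The Lie bracket of formal vector fields, `[v, w] h = v (w h) - w (v h)`. -/
def bracket (v w : VF F) : VF F := fun i => act v (w i) - act w (v i)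

/-- `Θ⁰₀ = z ∂/∂y - y ∂/∂z`. -/
def Theta : VF F := ![0, X 2, -X 1]

/-- `E = x ∂/∂x + (1/2) y ∂/∂y + (1/2) z ∂/∂z`. -/
def Euler : VF F := ![X 0, (2⁻¹ : F) • X 1, (2⁻¹ : F) • X 2]

/-- The formal function `y² + z²`. -/
def rho : MvPowerSeries (Fin 3) F := X 1 ^ 2 + X 2 ^ 2

/-- The quasi-Eulerian monomial `E^l_k = x^l (y² + z²)^(k-l) E`; it is meant for `l ≤ k` only. -/
def qE (F : Type*) [Field F] (l k : ℕ) : VF F := fun i => X 0 ^ l * rho ^ (k - l) * Euler i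

/-- The power series `∑_{l ≤ k} β^l_k x^l R^(k-l)` in two variables `x`, `R`. The values `β l k`
with `l > k` are not used. -/
def coeffSeries (β : ℕ → ℕ → F) : MvPowerSeries (Fin 2) F := fun d => β (d 0) (d 0 + d 1)

/-- The formal sum `∑_{l ≤ k} β^l_k E^l_k`, i.e. `f(x, y² + z²) E` with
`f(x, R) = ∑_{l ≤ k} β^l_k x^l R^(k-l)`. -/
def qESum (β : ℕ → ℕ → F) : VF F := fun i => subst ![X 0, rho] (coeffSeries β) * Euler i

/-- The space `𝓔` of all formal sums `∑ β^l_k E^l_k` over `l ≤ k`, `l + k ≥ 1`. It is also the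
space of generators of the permissible transformations. -/
def QE (F : Type*) [Field F] : Set (VF F) := {v | ∃ β : ℕ → ℕ → F, β 0 0 = 0 ∧ v = qESum β}

/-! ### Permissible transformations -/

/-- The time-one flow `exp(S)` of a formal vector field `S` without constant and linear terms:
its `i`-th component is `∑ₙ Sⁿ(xᵢ) / n!`. As `Sⁿ(xᵢ)` has order at least `n + 1`, only
the terms with `n ≤ |d|` contribute to the coefficient of the monomial with exponent `d`. -/
def timeOneFlow (S : VF F) : VF F := fun i d =>
  ∑ n ∈ Finset.range (d.degree + 1), ((n.factorial : F))⁻¹ * coeff d ((act S)^[n] (X i))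

/-- The permissible (near-identity) transformations: those generated by elements of `𝓔`. -/
def IsPermissible (φ : VF F) : Prop := ∃ S ∈ QE F, φ = timeOneFlow S

/-- The formal change of variables `(x, y, z) = φ(X, Y, Z)` transforms the vector field `v` into
the vector field `w`: `Dφ · w = v ∘ φ`. -/
def Transforms (φ v w : VF F) : Prop := ∀ i, act w (φ i) = subst φ (v i)

/-! ### Extended partial normal forms -/

/-- The homogeneous space `𝓔_n`, spanned by the `E^l_k` with `l ≤ k`, `l + k ≥ 1` and
`δ(E^l_k) = 2k - l = n`. -/
def gradeSpace (F : Type*) [Field F] (n : ℕ) : Submodule F (VF F) :=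
  Submodule.span F {v | ∃ l k : ℕ, l ≤ k ∧ 1 ≤ l + k ∧ 2 * k = n + l ∧ v = qE F l k}

/-- The component `v_n` of grade `n` of a vector field. The components of `E^l_k` are homogeneous
polynomials of degree `2k - l + 1 = δ(E^l_k) + 1`, and those of `Θ⁰₀` (of grade `0`) are
homogeneous of degree `1`. -/
def gradePart (n : ℕ) (v : VF F) : VF F := fun i d =>
  if d.degree = n + 1 then coeff d (v i) else 0

/-- `∑_{i<k} Y_{n-i} * v_i`, where `Y * v = [Y, v]`. -/
def stateSum (v : VF F) (n k : ℕ) (Y : ℕ → VF F) : VF F :=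
  ∑ i ∈ Finset.range k, bracket (Y (n - i)) (gradePart i v)

/-- `(Y_n, Y_{n-1}, …, Y_{n-k+1})` lies in the kernel of the `k`-th level state map `d^{n,k}`,
whose domain consists of the tuples with `(Y_{n-1}, …, Y_{n-k+1}) ∈ ker d^{n-1,k-1}`. -/
def InKer (v : VF F) : ℕ → ℕ → (ℕ → VF F) → Prop
  | _, 0, _ => True
  | n, k + 1, Y => InKer v (n - 1) k Y ∧ stateSum v n (k + 1) Y = 0

theorem bracket_add_left (a b w : VF F) : bracket (a + b) w = bracket a w + bracket b w := by
  funext i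
  simp only [bracket, act, Pi.add_apply, map_add, add_mul, mul_add, Finset.sum_add_distrib]
  ring

theorem bracket_smul_left (c : F) (a w : VF F) : bracket (c • a) w = c • bracket a w := by
  funext i
  simp only [bracket, act, Pi.smul_apply, Derivation.map_smul, smul_mul_assoc, mul_smul_comm,
    ← Finset.smul_sum, smul_sub]

theorem stateSum_add (v : VF F) (n k : ℕ) (Y Z : ℕ → VF F) :
    stateSum v n k (Y + Z) = stateSum v n k Y + stateSum v n k Z := by
  simp only [stateSum, Pi.add_apply (f := Y), bracket_add_left, Finset.sum_add_distrib]

theorem stateSum_smul (v : VF F) (n k : ℕ) (c : F) (Y : ℕ → VF F) :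
    stateSum v n k (c • Y) = c • stateSum v n k Y := by
  simp only [stateSum, Finset.smul_sum]
  exact Finset.sum_congr rfl fun i _ => bracket_smul_left c (Y (n - i)) (gradePart i v)

theorem inKer_add (v : VF F) (k : ℕ) : ∀ (n : ℕ) (Y Z : ℕ → VF F),
    InKer v n k Y → InKer v n k Z → InKer v n k (Y + Z) := by
  induction k with
  | zero => intro _ _ _ _ _; trivial
  | succ k ih =>
    intro n Y Z hY hZ
    exact ⟨ih _ _ _ hY.1 hZ.1, by rw [stateSum_add, hY.2, hZ.2, add_zero]⟩

theorem inKer_smul (v : VF F) (k : ℕ) : ∀ (n : ℕ) (c : F) (Y : ℕ → VF F),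
    InKer v n k Y → InKer v n k (c • Y) := by
  induction k with
  | zero => intro _ _ _ _; trivial
  | succ k ih =>
    intro n c Y hY
    exact ⟨ih _ _ _ hY.1, by rw [stateSum_smul, hY.2, smul_zero]⟩

/-- The image of the `k`-th level state map `d^{n,k}`, with `d^{n,k} = d^{n,n}` for `k > n`. -/
def stateImage (v : VF F) (n k : ℕ) : Submodule F (VF F) where
  carrier := {W | ∃ Y : ℕ → VF F, (∀ j, Y j ∈ gradeSpace F j) ∧
    InKer v (n - 1) (min k n - 1) Y ∧ W = stateSum v n (min k n) Y}
  add_mem' := by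
    rintro _ _ ⟨Y, hY, hY', rfl⟩ ⟨Z, hZ, hZ', rfl⟩
    exact ⟨Y + Z, fun j => add_mem (hY j) (hZ j), inKer_add _ _ _ _ _ hY' hZ',
      (stateSum_add _ _ _ _ _).symm⟩
  zero_mem' := by
    refine ⟨(0 : F) • (0 : ℕ → VF F), fun j => by simp, ?_, ?_⟩
    · have : ∀ (k n : ℕ), InKer v n k ((0 : F) • (0 : ℕ → VF F)) := by
        intro k
        induction k with
        | zero => intro _; trivial
        | succ k ih => intro n; exact ⟨ih _, by rw [stateSum_smul, zero_smul]⟩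
      exact this _ _
    · rw [stateSum_smul, zero_smul]
  smul_mem' := by
    rintro c _ ⟨Y, hY, hY', rfl⟩
    exact ⟨c • Y, fun j => Submodule.smul_mem _ c (hY j), inKer_smul _ _ _ _ _ hY',
      (stateSum_smul _ _ _ _ _).symm⟩

/-- The normal form style: `C` is a complement of the image of `d^{n,k}` in `𝓔_n` that is spanned
by some of the monomials `E^l_m` of grade `n`. -/
def IsStyleComplement (v : VF F) (n k : ℕ) (C : Submodule F (VF F)) : Prop :=
  (∃ I : Set (VF F), I ⊆ {w | ∃ l m : ℕ, l ≤ m ∧ 1 ≤ l + m ∧ 2 * m = n + l ∧ w = qE F l m} ∧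
    C = Submodule.span F I) ∧
  Disjoint (stateImage v n k) C ∧ stateImage v n k ⊔ C = gradeSpace F n

/-- `v` is in the `k`-th level extended partial normal form. -/
def IsLevelNF (v : VF F) (k : ℕ) : Prop :=
  ∀ n : ℕ, 1 ≤ n → ∃ C, IsStyleComplement v n k C ∧ gradePart n v ∈ C

/-- `v` is in the infinite level normal form. -/
def IsInfiniteNF (v : VF F) : Prop :=
  ∀ n : ℕ, 1 ≤ n → ∃ C, IsStyleComplement v n n C ∧ gradePart n v ∈ C

/-- `v` has no non-trivial symmetry: the infinite level co-normal form space `{S ∈ 𝓔 | [S, v] = 0}`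
consists of the multiples of the vector field `v - Θ⁰₀` itself only, and each permissible
transformation that leaves `v` invariant is generated by a multiple of `v - Θ⁰₀`. -/
def NoNontrivialSymmetry (v : VF F) : Prop :=
  (∀ S ∈ QE F, bracket S v = 0 → ∃ c : F, S = c • (v - Theta)) ∧
  ∀ φ : VF F, IsPermissible φ → Transforms φ v v → ∃ c : F, φ = timeOneFlow (c • (v - Theta))

/-- The coefficient `β⁰₁ (β¹₁ β¹₂ - β⁰₁ β²₂) / (β¹₁)²`; it is `β⁰₁ (β¹₂ - β⁰₁ β²₂)` when `β¹₁ = 1`. -/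
def specialCoeff (β : ℕ → ℕ → F) : F :=
  β 0 1 * (β 1 1 * β 1 2 - β 0 1 * β 2 2) / (β 1 1) ^ 2

end HopfZero

end

/-! Everything reduces to power series in two variables. A quasi-Eulerian field is `f(x, R) E` with
`R = y² + z²`, and since `E x = x` and `E R = R`, the bracket of `gE` and `fE` is `{g, f} E` with
`{g, f} = g N(f) - f N(g)`, where `N = x ∂/∂x + R ∂/∂R` multiplies each monomial by its degree
(`bracket_psi`). `Θ⁰₀` commutes with all these fields, so the flow of `gE` sends `Θ⁰₀ + fE` to `Θ⁰₀
+ (exp(ad g) f) E` (`transforms_timeOneFlow_iff`), and such flows are closed under composition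
(`exists_expMap_comp`).

Let `L = a x + b R` be the linear part of `f`, with `a ≠ 0`. For `δ` of order `k`, the leading part
of `{δ, f}` is `(1 - k) L δ` (`ad_sub_mem_ordGE`). Modulo pure powers of `R`, multiplication by `L`
is bijective onto the multiples of `x`. Generators of degree `k ≥ 2` therefore remove every multiple
of `x` of degree at least three (`exists_ad_normalize`), and they are determined by what they remove
(`mem_ordGE_of_ad`). At `k = 1` the factor vanishes, so nothing of degree at most two can be
removed.

Two linear directions of generators remain. One is spanned by the field itself and acts trivially.
For the other, choose `p`, `q` so that `L (1 + p x + q R)` carries the `x²` and `xR` terms of `f`;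
its `R²` term is then `b q`, which is the special coefficient. The series `R (1 + p x + q R)`
commutes with this leading part (`ad_leadSym_lead`), so it acts only on the tail `b_r R^r + ...`,
with leading effect `(r - 1) b_r R^(r+1)`. Hence it removes exactly the term `R^(r+1)`, which gives
existence (`exists_flowEquiv_simplest`).

The same decomposition of generators shows that `R^(r+1)` is the only pure power of `R` that leads a
bracket (`eq_of_coeff_ad_ne_zero`), and that only multiples of the field commute with it when `b_r ≠
0` (`eq_smul_of_ad_eq_zero`). The former is translated to the state maps through the grading with
weights 1 for `x` and 2 for `R` (`mem_stateImage_of_wtPart`, `exists_of_mem_stateImage`). -/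

noncomputable section

namespace HopfZero

open MvPowerSeries

/-! ### Filtration of power series by order, and successive approximation -/

section Order

variable {F : Type*} [Field F] {σ τ υ : Type*}

variable (F σ) in
/-- The power series all of whose monomials have degree at least `n`. -/
def ordGE (n : ℕ) : Submodule F (MvPowerSeries σ F) where
  carrier := {h | ∀ d : σ →₀ ℕ, d.degree < n → coeff d h = 0}
  add_mem' ha hb d hd := by rw [map_add, ha d hd, hb d hd, add_zero]
  zero_mem' _ _ := map_zero _
  smul_mem' c a ha d hd := by rw [map_smul, ha d hd, smul_zero]

theorem mem_ordGE_iff_le_order {n : ℕ} {h : MvPowerSeries σ F} :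
    h ∈ ordGE F σ n ↔ (n : ℕ∞) ≤ h.order :=
  ⟨fun hh => nat_le_order hh, fun hh d hd =>
    coeff_of_lt_order (lt_of_lt_of_le (by exact_mod_cast hd) hh)⟩

theorem ordGE_anti {m n : ℕ} (hmn : m ≤ n) {h : MvPowerSeries σ F} (hh : h ∈ ordGE F σ n) :
    h ∈ ordGE F σ m := fun d hd => hh d (hd.trans_le hmn)

theorem mem_ordGE_zero (h : MvPowerSeries σ F) : h ∈ ordGE F σ 0 :=
  fun _ hd => absurd hd (Nat.not_lt_zero _)

theorem eq_zero_of_forall_mem_ordGE {h : MvPowerSeries σ F} (hh : ∀ n, h ∈ ordGE F σ n) :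
    h = 0 := MvPowerSeries.ext fun d => hh (d.degree + 1) d (Nat.lt_succ_self _)

theorem eq_of_forall_sub_mem_ordGE {h k : MvPowerSeries σ F}
    (hh : ∀ n, h - k ∈ ordGE F σ n) : h = k :=
  sub_eq_zero.mp (eq_zero_of_forall_mem_ordGE hh)

theorem mul_mem_ordGE {m n : ℕ} {a b : MvPowerSeries σ F} (ha : a ∈ ordGE F σ m)
    (hb : b ∈ ordGE F σ n) : a * b ∈ ordGE F σ (m + n) := by
  rw [mem_ordGE_iff_le_order] at *
  push_cast
  exact (add_le_add ha hb).trans le_order_mul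

theorem X_mem_ordGE (i : σ) : (X i : MvPowerSeries σ F) ∈ ordGE F σ 1 := by
  classical
  intro d hd
  have : d = 0 := (Finsupp.degree_eq_zero_iff d).mp (by omega)
  rw [this, coeff_zero_X]

theorem mem_ordGE_one {h : MvPowerSeries σ F} : h ∈ ordGE F σ 1 ↔ coeff 0 h = 0 := by
  refine ⟨fun hh => hh 0 (by simp), fun hh d hd => ?_⟩
  have : d = 0 := (Finsupp.degree_eq_zero_iff d).mp (by omega)
  rw [this, hh]

theorem pderiv_mem_ordGE {n : ℕ} (i : σ) {h : MvPowerSeries σ F} (hh : h ∈ ordGE F σ (n + 1)) :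
    pderiv F i h ∈ ordGE F σ n := by
  intro d hd
  rw [coeff_pderiv, hh _ (by simpa [Finsupp.degree_single] using hd), zero_mul]

/-- The linear map `T` raises the order by at least `k`. -/
def Raises (T : MvPowerSeries σ F →ₗ[F] MvPowerSeries τ F) (k : ℕ) : Prop :=
  ∀ n, ∀ h ∈ ordGE F σ n, T h ∈ ordGE F τ (n + k)

theorem Raises.mono {T : MvPowerSeries σ F →ₗ[F] MvPowerSeries τ F} {j k : ℕ} (hT : Raises T k)
    (hjk : j ≤ k) : Raises T j := fun n h hh => ordGE_anti (by omega) (hT n h hh)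

theorem Raises.add {T U : MvPowerSeries σ F →ₗ[F] MvPowerSeries τ F} {k : ℕ} (hT : Raises T k)
    (hU : Raises U k) : Raises (T + U) k := fun n h hh => add_mem (hT n h hh) (hU n h hh)

theorem Raises.comp {T : MvPowerSeries σ F →ₗ[F] MvPowerSeries τ F}
    {U : MvPowerSeries τ F →ₗ[F] MvPowerSeries υ F} {j k : ℕ} (hU : Raises U j)
    (hT : Raises T k) : Raises (U ∘ₗ T) (k + j) := fun n h hh => by
  rw [← add_assoc]; exact hU _ _ (hT n h hh)

theorem Raises.pow {P : Module.End F (MvPowerSeries σ F)} {k : ℕ} (hP : Raises P k) (m : ℕ) :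
    Raises (P ^ m) (m * k) := by
  induction m with
  | zero => intro n h hh; simpa using hh
  | succ m ih =>
    intro n h hh
    rw [pow_succ']
    have := hP _ _ (ih n h hh)
    rwa [show n + m * k + k = n + (m + 1) * k by ring] at this

/-- Both maps are continuous for the order filtration and polynomials are dense: truncating at total
degree `n` changes the values only in order at least `n`. Identities between linear maps thereby
reduce to monomials. -/
theorem raises_ext [Finite σ] {T U : MvPowerSeries σ F →ₗ[F] MvPowerSeries τ F}
    (hT : Raises T 0) (hU : Raises U 0)
    (h : ∀ d : σ →₀ ℕ, T (monomial d 1) = U (monomial d 1)) : T = U := by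
  have hpoly : ∀ p : MvPolynomial σ F, T p = U p := by
    intro p
    induction p using MvPolynomial.induction_on' with
    | monomial d a =>
      have : (MvPolynomial.monomial d a : MvPowerSeries σ F) = a • monomial d (1 : F) := by
        rw [MvPolynomial.coe_monomial, ← map_smul, smul_eq_mul, mul_one]
      rw [this, map_smul, map_smul, h]
    | add p q hp hq => rw [MvPolynomial.coe_add, map_add, map_add, hp, hq]
  ext1 a
  refine eq_of_forall_sub_mem_ordGE fun n => ?_
  have ha : a - (truncTotal n a : MvPolynomial σ F) ∈ ordGE F σ n := by
    intro d hd
    rw [map_sub, MvPolynomial.coeff_coe, coeff_truncTotal _ hd, sub_self]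
  have e : T a - U a = T (a - (truncTotal n a : MvPolynomial σ F))
      - U (a - (truncTotal n a : MvPolynomial σ F)) := by
    rw [map_sub, map_sub, hpoly]; ring
  rw [e]
  exact sub_mem (hT _ _ ha) (hU _ _ ha)

theorem subst_mem_ordGE {φ : σ → MvPowerSeries τ F} (hs : HasSubst φ)
    (hφ : ∀ i, φ i ∈ ordGE F τ 1) {n : ℕ} {h : MvPowerSeries σ F} (hh : h ∈ ordGE F σ n) :
    subst φ h ∈ ordGE F τ n := by
  intro e he
  rw [coeff_subst hs]
  refine finsum_eq_zero_of_forall_eq_zero fun d => ?_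
  by_cases hd : d.degree < n
  · rw [hh d hd, zero_smul]
  · have : (d.prod fun s e => φ s ^ e) ∈ ordGE F τ d.degree := by
      rw [mem_ordGE_iff_le_order, Finsupp.prod]
      refine le_trans ?_ (le_order_prod _ _)
      rw [Finsupp.degree_apply, Nat.cast_sum]
      refine Finset.sum_le_sum fun i _ => ?_
      refine le_order_pow_of_constantCoeff_eq_zero _ ?_
      rw [← coeff_zero_eq_constantCoeff_apply]
      exact mem_ordGE_one.mp (hφ i)
    rw [this e (by omega), smul_zero]

theorem hasSubst_of_mem_ordGE [Finite σ] {φ : σ → MvPowerSeries τ F}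
    (hφ : ∀ i, φ i ∈ ordGE F τ 1) : HasSubst φ :=
  hasSubst_of_constantCoeff_zero fun i => by
    rw [← coeff_zero_eq_constantCoeff_apply]
    exact mem_ordGE_one.mp (hφ i)

/-- An algebra homomorphism compatible with the orders is the substitution of the images of the
variables. -/
theorem subst_eq_algHom [Finite σ] (T : MvPowerSeries σ F →ₐ[F] MvPowerSeries τ F)
    (hT : Raises T.toLinearMap 0) (h : MvPowerSeries σ F) :
    subst (fun i => T (X i)) h = T h := by
  have hφ : ∀ i, T (X i) ∈ ordGE F τ 1 := fun i => hT 1 _ (X_mem_ordGE i)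
  have hs := hasSubst_of_mem_ordGE hφ
  have := raises_ext (T := (substAlgHom hs : MvPowerSeries σ F →ₐ[F] _).toLinearMap)
    (U := T.toLinearMap) (fun n k hk => by
      simpa [coe_substAlgHom] using subst_mem_ordGE hs hφ hk) hT (fun d => by
      simp only [AlgHom.toLinearMap_apply, coe_substAlgHom]
      rw [subst_monomial hs, map_one, one_mul, monomial_one_eq, Finsupp.prod, Finsupp.prod, map_prod]
      simp)
  simpa [coe_substAlgHom] using LinearMap.congr_fun this h

/-- Successive approximation: a property of power series that at stage `k` depends only on the
terms of degree less than `k`, and can be continued from each stage to the next one. -/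
theorem exists_forall_of_step {P : ℕ → MvPowerSeries σ F → Prop} {M : ℕ} {g₀ : MvPowerSeries σ F}
    (h₀ : P M g₀) (hcongr : ∀ k ≥ M, ∀ g g', g' - g ∈ ordGE F σ k → P k g → P k g')
    (hstep : ∀ k ≥ M, ∀ g, P k g → ∃ δ ∈ ordGE F σ k, P (k + 1) (g + δ)) :
    ∃ g, g - g₀ ∈ ordGE F σ M ∧ ∀ k ≥ M, P k g := by
  classical
  choose! δ hδ hP using hstep
  let s : ℕ → MvPowerSeries σ F := fun n => Nat.rec g₀ (fun n g => g + δ (M + n) g) n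
  have hs : ∀ n, P (M + n) (s n) := by
    intro n
    induction n with
    | zero => exact h₀
    | succ n ih => exact hP (M + n) (by omega) _ ih
  have hinc : ∀ n j, s (n + j) - s n ∈ ordGE F σ (M + n) := by
    intro n j
    induction j with
    | zero => simp
    | succ j ih =>
      have e : s (n + (j + 1)) - s n = (s (n + j) - s n) + δ (M + (n + j)) (s (n + j)) := by
        change s (n + j) + δ (M + (n + j)) (s (n + j)) - s n = _
        ring
      rw [e]
      exact add_mem ih (ordGE_anti (by omega) (hδ _ (by omega) _ (hs _)))
  -- Corrections after stage `d.degree + 1` have order greater than `d.degree`, so the coefficient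
  -- at `d` no longer changes.
  let g : MvPowerSeries σ F := fun d => coeff d (s (d.degree + 1))
  have hg : ∀ n, g - s n ∈ ordGE F σ (M + n) := by
    intro n d hd
    have hgd : coeff d g = coeff d (s (d.degree + 1)) := rfl
    rw [map_sub, hgd, ← map_sub]
    rcases le_total n (d.degree + 1) with hn | hn
    · obtain ⟨j, hj⟩ := Nat.exists_eq_add_of_le hn
      rw [hj]
      exact hinc n j d hd
    · obtain ⟨j, hj⟩ := Nat.exists_eq_add_of_le hn
      rw [hj, ← neg_sub, map_neg, hinc (d.degree + 1) j d (by omega), neg_zero]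
  refine ⟨g, hg 0, fun k hk => ?_⟩
  obtain ⟨n, rfl⟩ := Nat.exists_eq_add_of_le hk
  exact hcongr _ hk _ _ (hg n) (hs n)

end Order

/-! ### Exponentials of order-raising operators -/

section Exp

variable {F : Type*} [Field F] {σ τ υ : Type*}

/-- The exponential of a linear map that raises the order. -/
def expMap (P : Module.End F (MvPowerSeries σ F)) (h : MvPowerSeries σ F) : MvPowerSeries σ F :=
  fun d => ∑ n ∈ Finset.range (d.degree + 1), ((n.factorial : F))⁻¹ * coeff d ((P ^ n) h)

theorem coeff_expMap (P : Module.End F (MvPowerSeries σ F)) (h : MvPowerSeries σ F)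
    (d : σ →₀ ℕ) : coeff d (expMap P h) =
      ∑ n ∈ Finset.range (d.degree + 1), ((n.factorial : F))⁻¹ * coeff d ((P ^ n) h) := rfl

/-- The partial sums of the exponential series. -/
def expSum (P : Module.End F (MvPowerSeries σ F)) (h : MvPowerSeries σ F) (M : ℕ) :
    MvPowerSeries σ F :=
  ∑ n ∈ Finset.range M, ((n.factorial : F))⁻¹ • (P ^ n) h

variable {P Q : Module.End F (MvPowerSeries σ F)}

/-- `P ^ n` sends order `a` to order at least `a + n`, so below degree `a + M` neither the cutoff at
`d.degree + 1` nor the cutoff at `M` loses a non-zero term. -/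
theorem expMap_sub_expSum (hP : Raises P 1) {a : ℕ} {h : MvPowerSeries σ F}
    (hh : h ∈ ordGE F σ a) (M : ℕ) : expMap P h - expSum P h M ∈ ordGE F σ (a + M) := by
  intro d hd
  have hz : ∀ n, d.degree < a + n → ((n.factorial : F))⁻¹ * coeff d ((P ^ n) h) = 0 := by
    intro n hn
    rw [hP.pow n a h hh d (by simpa using hn), mul_zero]
  rw [map_sub, coeff_expMap, expSum, map_sum, sub_eq_zero]
  simp only [map_smul, smul_eq_mul]
  rcases le_total (d.degree + 1) M with h' | h'
  · refine Finset.sum_subset (Finset.range_subset_range.mpr h') fun n _ hn => hz n ?_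
    simp only [Finset.mem_range] at hn
    omega
  · refine (Finset.sum_subset (Finset.range_subset_range.mpr h') fun n _ hn => hz n ?_).symm
    simp only [Finset.mem_range] at hn
    omega

theorem expMap_raises_sub (hP : Raises P 1) {a : ℕ} {h : MvPowerSeries σ F}
    (hh : h ∈ ordGE F σ a) : expMap P h - h ∈ ordGE F σ (a + 1) := by
  simpa [expSum] using expMap_sub_expSum hP hh 1

theorem expMap_sub_two (hP : Raises P 1) {a : ℕ} {h : MvPowerSeries σ F}
    (hh : h ∈ ordGE F σ a) : expMap P h - (h + P h) ∈ ordGE F σ (a + 2) := by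
  simpa [expSum, Finset.sum_range_succ] using expMap_sub_expSum hP hh 2

theorem expMap_mem_ordGE (hP : Raises P 1) {a : ℕ} {h : MvPowerSeries σ F}
    (hh : h ∈ ordGE F σ a) : expMap P h ∈ ordGE F σ a := by
  have := add_mem (ordGE_anti (Nat.le_succ a) (expMap_raises_sub hP hh)) hh
  simpa using this

theorem expMap_add (P : Module.End F (MvPowerSeries σ F)) (h k : MvPowerSeries σ F) :
    expMap P (h + k) = expMap P h + expMap P k := by
  ext d
  simp only [coeff_expMap, map_add, mul_add, Finset.sum_add_distrib]

theorem expMap_smul (P : Module.End F (MvPowerSeries σ F)) (c : F) (h : MvPowerSeries σ F) :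
    expMap P (c • h) = c • expMap P h := by
  ext d
  simp only [coeff_expMap, map_smul, smul_eq_mul, Finset.mul_sum]
  exact Finset.sum_congr rfl fun _ _ => by ring

theorem expMap_of_map_eq_zero {h : MvPowerSeries σ F} (hh : P h = 0) : expMap P h = h := by
  ext d
  rw [coeff_expMap, Finset.sum_range_succ', Finset.sum_eq_zero]
  · simp
  · intro n _
    rw [pow_succ, Module.End.mul_apply, hh, map_zero, map_zero, mul_zero]

/-- The exponential as a linear map. -/
def expLin (P : Module.End F (MvPowerSeries σ F)) : Module.End F (MvPowerSeries σ F) where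
  toFun := expMap P
  map_add' := expMap_add P
  map_smul' := expMap_smul P

/-- If the exponential of `P` fixes `h` then `P` annihilates `h`. -/
theorem map_eq_zero_of_expMap_eq (hP : Raises P 1) {h : MvPowerSeries σ F}
    (hh : expMap P h = h) : P h = 0 := by
  refine eq_zero_of_forall_mem_ordGE fun n => ?_
  induction n with
  | zero => exact mem_ordGE_zero _
  | succ m ih =>
    -- From `exp(P) h = h`, the term `P h` is minus the sum of the terms with exponent at least two,
    -- and each of these has higher order than `P h` is known to have.
    have key := expMap_sub_expSum hP (mem_ordGE_zero h) (m + 2)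
    rw [hh, expSum, Finset.sum_range_succ', Finset.sum_range_succ'] at key
    simp only [zero_add, pow_zero, pow_one, Nat.factorial_zero, Nat.factorial_one, Nat.cast_one,
      inv_one, one_smul, Module.End.one_apply] at key
    have hs : ∑ k ∈ Finset.range m, (((k + 1 + 1).factorial : F))⁻¹ • (P ^ (k + 1 + 1)) h
        ∈ ordGE F σ (m + 1) := by
      refine Submodule.sum_mem _ fun k _ => Submodule.smul_mem _ _ ?_
      rw [pow_succ, Module.End.mul_apply]
      exact ordGE_anti (by omega) (hP.pow (k + 1) m _ ih)
    have := neg_mem (add_mem (ordGE_anti (by omega) key : _ ∈ ordGE F σ (m + 1)) hs)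
    convert this using 1
    ring

/-- The leading effect of a perturbation of the exponent. -/
theorem expMap_add_sub (hP : Raises P 1) {k : ℕ} (hk : 1 ≤ k) (hQ : Raises Q k) {a : ℕ}
    {h : MvPowerSeries σ F} (hh : h ∈ ordGE F σ a) :
    expMap (P + Q) h - (expMap P h + Q h) ∈ ordGE F σ (a + k + 1) := by
  have hPQ : Raises (P + Q) 1 := hP.add (hQ.mono hk)
  -- Each further factor beside one `Q` gains an order, so only the first power contributes in
  -- degree `a + k`, namely `Q h`.
  have hd : ∀ n, ((P + Q) ^ (n + 1)) h - (P ^ (n + 1)) h ∈ ordGE F σ (a + k + n) := by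
    intro n
    induction n with
    | zero =>
      simpa using hQ a h hh
    | succ n ih =>
      have e : ((P + Q) ^ (n + 1 + 1)) h - (P ^ (n + 1 + 1)) h
          = (P + Q) (((P + Q) ^ (n + 1)) h - (P ^ (n + 1)) h) + Q ((P ^ (n + 1)) h) := by
        rw [pow_succ' (P + Q), pow_succ' P (n + 1), Module.End.mul_apply, Module.End.mul_apply,
          map_sub, LinearMap.add_apply, LinearMap.add_apply]
        abel
      rw [e]
      refine add_mem (hPQ _ _ ih) (ordGE_anti ?_ (hQ _ _ (hP.pow (n + 1) a h hh)))
      omega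
  intro d hdeg
  have hPQs := expMap_sub_expSum hPQ hh (k + 2)
  have hPs := expMap_sub_expSum hP hh (k + 2)
  have hdiff : expSum (P + Q) h (k + 2) - expSum P h (k + 2) - Q h ∈ ordGE F σ (a + k + 1) := by
    rw [expSum, expSum, ← Finset.sum_sub_distrib, Finset.sum_range_succ',
      Finset.sum_range_succ']
    simp only [← smul_sub, zero_add, pow_zero, pow_one, Nat.factorial_zero, Nat.factorial_one,
      Nat.cast_one, inv_one, one_smul, sub_self, add_zero, LinearMap.add_apply, add_sub_cancel_left,
      add_sub_cancel_right]
    refine Submodule.sum_mem _ fun j _ => Submodule.smul_mem _ _ ?_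
    exact ordGE_anti (by omega) (hd (j + 1))
  have e : expMap (P + Q) h - (expMap P h + Q h)
      = (expMap (P + Q) h - expSum (P + Q) h (k + 2)) - (expMap P h - expSum P h (k + 2))
        + (expSum (P + Q) h (k + 2) - expSum P h (k + 2) - Q h) := by ring
  rw [e]
  exact add_mem (sub_mem (ordGE_anti (by omega) hPQs) (ordGE_anti (by omega) hPs)) hdiff d hdeg

/-- Exponents that agree up to order `k` have exponentials that agree up to order `k`. -/
theorem expMap_add_sub_mem (hP : Raises P 1) {k : ℕ} (hk : 1 ≤ k) (hQ : Raises Q k) {a : ℕ}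
    {h : MvPowerSeries σ F} (hh : h ∈ ordGE F σ a) :
    expMap (P + Q) h - expMap P h ∈ ordGE F σ (a + k) := by
  have := add_mem (ordGE_anti (Nat.le_succ _) (expMap_add_sub hP hk hQ hh)) (hQ a h hh)
  convert this using 1
  ring

/-- The exponential commutes with maps that intertwine the exponents. -/
theorem expMap_intertwine {P' : Module.End F (MvPowerSeries τ F)} (hP : Raises P 1)
    (hP' : Raises P' 1) {T : MvPowerSeries σ F →ₗ[F] MvPowerSeries τ F} (hT : Raises T 0)
    (hc : ∀ h, P' (T h) = T (P h)) (h : MvPowerSeries σ F) :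
    expMap P' (T h) = T (expMap P h) := by
  have hpow : ∀ n, (P' ^ n) (T h) = T ((P ^ n) h) := by
    intro n
    induction n with
    | zero => rfl
    | succ n ih => rw [pow_succ', pow_succ', Module.End.mul_apply, Module.End.mul_apply, ih, hc]
  refine eq_of_forall_sub_mem_ordGE fun n => ?_
  have h1 := expMap_sub_expSum hP' (mem_ordGE_zero (T h)) n
  have h2 := hT _ _ (expMap_sub_expSum hP (mem_ordGE_zero h) n)
  have h3 : expSum P' (T h) n = T (expSum P h n) := by
    simp only [expSum, map_sum, map_smul, hpow]
  rw [map_sub, ← h3] at h2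
  have := sub_mem h1 h2
  simpa using this

theorem expMap_comm {Q : Module.End F (MvPowerSeries σ F)} (hP : Raises P 1) (hQ : Raises Q 0)
    (hc : ∀ h, P (Q h) = Q (P h)) (h : MvPowerSeries σ F) :
    expMap P (Q h) = Q (expMap P h) := expMap_intertwine hP hP hQ hc h

variable [CharZero F]

/-- The binomial form of the Leibniz rule with divided powers. In the induction the claim is
multiplied by `n + 1 = i + j`: the summand `i` is absorbed by one application of `P₁`, the summand
`j` by one of `P₂`. Characteristic zero allows cancelling `n + 1`. -/
theorem leibniz_pow {P₁ : Module.End F (MvPowerSeries σ F)} {P₂ : Module.End F (MvPowerSeries τ F)}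
    {P₃ : Module.End F (MvPowerSeries υ F)}
    (μ : MvPowerSeries σ F →ₗ[F] MvPowerSeries τ F →ₗ[F] MvPowerSeries υ F)
    (hc : ∀ a b, P₃ (μ a b) = μ (P₁ a) b + μ a (P₂ b)) (a : MvPowerSeries σ F)
    (b : MvPowerSeries τ F) (n : ℕ) :
    ((n.factorial : F))⁻¹ • (P₃ ^ n) (μ a b) = ∑ ij ∈ Finset.HasAntidiagonal.antidiagonal n,
      μ (((ij.1.factorial : F))⁻¹ • (P₁ ^ ij.1) a) (((ij.2.factorial : F))⁻¹ • (P₂ ^ ij.2) b) := by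
  induction n with
  | zero => simp
  | succ n ih =>
    have hn : ((n + 1 : ℕ) : F) ≠ 0 := by exact_mod_cast Nat.succ_ne_zero n
    have key : ((n + 1 : ℕ) : F) • (((n + 1).factorial : F))⁻¹ • (P₃ ^ (n + 1)) (μ a b)
        = P₃ (((n.factorial : F))⁻¹ • (P₃ ^ n) (μ a b)) := by
      rw [pow_succ', Module.End.mul_apply, map_smul, smul_smul, Nat.factorial_succ, Nat.cast_mul,
        mul_inv, ← mul_assoc, mul_inv_cancel₀ hn, one_mul]
    have hA : ∀ i : ℕ, P₁ (((i.factorial : F))⁻¹ • (P₁ ^ i) a)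
        = ((i + 1 : ℕ) : F) • (((i + 1).factorial : F))⁻¹ • (P₁ ^ (i + 1)) a := by
      intro i
      have hi : ((i + 1 : ℕ) : F) ≠ 0 := by exact_mod_cast Nat.succ_ne_zero i
      rw [pow_succ', Module.End.mul_apply, map_smul, smul_smul, Nat.factorial_succ, Nat.cast_mul,
        mul_inv, ← mul_assoc, mul_inv_cancel₀ hi, one_mul]
    have hB : ∀ i : ℕ, P₂ (((i.factorial : F))⁻¹ • (P₂ ^ i) b)
        = ((i + 1 : ℕ) : F) • (((i + 1).factorial : F))⁻¹ • (P₂ ^ (i + 1)) b := by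
      intro i
      have hi : ((i + 1 : ℕ) : F) ≠ 0 := by exact_mod_cast Nat.succ_ne_zero i
      rw [pow_succ', Module.End.mul_apply, map_smul, smul_smul, Nat.factorial_succ, Nat.cast_mul,
        mul_inv, ← mul_assoc, mul_inv_cancel₀ hi, one_mul]
    refine smul_right_injective _ hn ?_
    change ((n + 1 : ℕ) : F) • _ = ((n + 1 : ℕ) : F) • _
    rw [key, ih, map_sum]
    simp only [hc, hA, hB]
    rw [Finset.sum_add_distrib]
    have e1 : ((n + 1 : ℕ) : F) • ∑ ij ∈ Finset.HasAntidiagonal.antidiagonal (n + 1),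
        μ (((ij.1.factorial : F))⁻¹ • (P₁ ^ ij.1) a) (((ij.2.factorial : F))⁻¹ • (P₂ ^ ij.2) b)
        = ∑ ij ∈ Finset.HasAntidiagonal.antidiagonal (n + 1), ((ij.1 : F) •
          μ (((ij.1.factorial : F))⁻¹ • (P₁ ^ ij.1) a) (((ij.2.factorial : F))⁻¹ • (P₂ ^ ij.2) b))
        + ∑ ij ∈ Finset.HasAntidiagonal.antidiagonal (n + 1), ((ij.2 : F) •
          μ (((ij.1.factorial : F))⁻¹ • (P₁ ^ ij.1) a)
            (((ij.2.factorial : F))⁻¹ • (P₂ ^ ij.2) b)) := by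
      rw [Finset.smul_sum, ← Finset.sum_add_distrib]
      refine Finset.sum_congr rfl fun ij hij => ?_
      rw [← add_smul, ← Nat.cast_add, Finset.HasAntidiagonal.mem_antidiagonal.mp hij]
    rw [e1, Finset.Nat.sum_antidiagonal_succ, Finset.Nat.sum_antidiagonal_succ'
      (f := fun ij : ℕ × ℕ => (ij.2 : F) • μ (((ij.1.factorial : F))⁻¹ • (P₁ ^ ij.1) a)
        (((ij.2.factorial : F))⁻¹ • (P₂ ^ ij.2) b))]
    simp only [Nat.cast_zero, zero_smul, zero_add, map_smul, LinearMap.smul_apply]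
    congr 1
    exact Finset.sum_congr rfl fun _ _ => smul_comm _ _ _

/-- The exponentials of operators that satisfy a Leibniz rule with respect to a bilinear map are
compatible with this bilinear map. -/
theorem expMap_bilin {P₁ : Module.End F (MvPowerSeries σ F)}
    {P₂ : Module.End F (MvPowerSeries τ F)} {P₃ : Module.End F (MvPowerSeries υ F)}
    (h₁ : Raises P₁ 1) (h₂ : Raises P₂ 1) (h₃ : Raises P₃ 1)
    (μ : MvPowerSeries σ F →ₗ[F] MvPowerSeries τ F →ₗ[F] MvPowerSeries υ F)
    (hμ : ∀ m n, ∀ a ∈ ordGE F σ m, ∀ b ∈ ordGE F τ n, μ a b ∈ ordGE F υ (m + n))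
    (hc : ∀ a b, P₃ (μ a b) = μ (P₁ a) b + μ a (P₂ b)) (a : MvPowerSeries σ F)
    (b : MvPowerSeries τ F) :
    expMap P₃ (μ a b) = μ (expMap P₁ a) (expMap P₂ b) := by
  refine eq_of_forall_sub_mem_ordGE fun M => ?_
  let g : ℕ → ℕ → MvPowerSeries υ F := fun i j =>
    μ (((i.factorial : F))⁻¹ • (P₁ ^ i) a) (((j.factorial : F))⁻¹ • (P₂ ^ j) b)
  have hg : ∀ i j, g i j ∈ ordGE F υ (i + j) := fun i j =>
    hμ _ _ _ (Submodule.smul_mem _ _ (by simpa using h₁.pow i 0 a (mem_ordGE_zero a)))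
      _ (Submodule.smul_mem _ _ (by simpa using h₂.pow j 0 b (mem_ordGE_zero b)))
  have d1 := expMap_sub_expSum h₁ (mem_ordGE_zero a) M
  have d2 := expMap_sub_expSum h₂ (mem_ordGE_zero b) M
  have d3 := expMap_sub_expSum h₃ (mem_ordGE_zero (μ a b)) M
  rw [zero_add] at d1 d2 d3
  have s3 : expSum P₃ (μ a b) M = ∑ i ∈ Finset.range M, ∑ j ∈ Finset.range (M - i), g i j := by
    rw [← Finset.sum_range_diag_flip, expSum]
    refine Finset.sum_congr rfl fun n _ => ?_
    rw [leibniz_pow μ hc, Finset.Nat.sum_antidiagonal_eq_sum_range_succ_mk]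
  have s12 : μ (expSum P₁ a M) (expSum P₂ b M)
      = ∑ i ∈ Finset.range M, ∑ j ∈ Finset.range M, g i j := by
    simp only [expSum, map_sum, LinearMap.sum_apply, g]
    rw [Finset.sum_comm]
  -- The triangle `i + j < M` and the square `i, j < M` differ by terms with `i + j ≥ M`, all of
  -- order at least `M`.
  have hdiff : expSum P₃ (μ a b) M - μ (expSum P₁ a M) (expSum P₂ b M) ∈ ordGE F υ M := by
    rw [s3, s12, ← Finset.sum_sub_distrib]
    refine Submodule.sum_mem _ fun i _ => ?_
    rw [← neg_mem_iff, neg_sub, ← Finset.sum_sdiff_eq_sub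
      (Finset.range_subset_range.mpr (Nat.sub_le M i))]
    refine Submodule.sum_mem _ fun j hj => ordGE_anti ?_ (hg i j)
    simp only [Finset.mem_sdiff, Finset.mem_range] at hj
    omega
  have e : expMap P₃ (μ a b) - μ (expMap P₁ a) (expMap P₂ b)
      = (expMap P₃ (μ a b) - expSum P₃ (μ a b) M)
        + (expSum P₃ (μ a b) M - μ (expSum P₁ a M) (expSum P₂ b M))
        - (μ (expMap P₁ a - expSum P₁ a M) (expMap P₂ b)
          + μ (expSum P₁ a M) (expMap P₂ b - expSum P₂ b M)) := by
    simp only [map_sub, LinearMap.sub_apply]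
    ring
  rw [e]
  refine sub_mem (add_mem d3 hdiff) (add_mem ?_ ?_)
  · simpa using hμ M 0 _ d1 _ (mem_ordGE_zero _)
  · simpa using hμ 0 M _ (mem_ordGE_zero _) _ d2

end Exp

/-! ### Formal vector fields as derivations -/

section Derivations

variable {F : Type*} [Field F]

/-- The derivation defined by a formal vector field. -/
def actDer (v : VF F) : Derivation F (MvPowerSeries (Fin 3) F) (MvPowerSeries (Fin 3) F) :=
  v 0 • pderiv F 0 + v 1 • pderiv F 1 + v 2 • pderiv F 2

theorem actDer_apply (v : VF F) (h : MvPowerSeries (Fin 3) F) : actDer v h = act v h := by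
  simp [actDer, act, Fin.sum_univ_three]

/-- The action of a formal vector field as a linear map. -/
def actLin (v : VF F) : Module.End F (MvPowerSeries (Fin 3) F) := (actDer v).toLinearMap

theorem actLin_apply (v : VF F) (h : MvPowerSeries (Fin 3) F) : actLin v h = act v h :=
  actDer_apply v h

theorem act_mul (v : VF F) (a b : MvPowerSeries (Fin 3) F) :
    act v (a * b) = act v a * b + a * act v b := by
  rw [← actDer_apply, Derivation.leibniz, actDer_apply, actDer_apply, smul_eq_mul, smul_eq_mul]
  ring

theorem act_X (v : VF F) (i : Fin 3) : act v (X i) = v i := by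
  classical
  simp [act, pderiv_X, Pi.single_apply]

theorem actLin_raises {v : VF F} {k : ℕ} (hv : ∀ i, v i ∈ ordGE F (Fin 3) (k + 1)) :
    Raises (actLin v) k := by
  intro n h hh
  rw [actLin_apply, act]
  refine Submodule.sum_mem _ fun j _ => ?_
  cases n with
  | zero => exact ordGE_anti (by omega) (mul_mem_ordGE (hv j) (mem_ordGE_zero _))
  | succ n => exact ordGE_anti (by omega) (mul_mem_ordGE (hv j) (pderiv_mem_ordGE j hh))

theorem pderiv_comm {σ : Type*} (i j : σ) (h : MvPowerSeries σ F) :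
    pderiv F i (pderiv F j h) = pderiv F j (pderiv F i h) := by
  classical
  ext d
  simp only [coeff_pderiv, Finsupp.add_apply, Finsupp.single_apply]
  rw [add_right_comm]
  by_cases hij : i = j
  · subst hij; ring
  · rw [if_neg hij, if_neg (Ne.symm hij)]
    push_cast
    ring

/-- The second-order terms cancel because partial derivatives commute. -/
theorem act_bracket (v w : VF F) (h : MvPowerSeries (Fin 3) F) :
    act (bracket v w) h = act v (act w h) - act w (act v h) := by
  simp only [act, bracket, Fin.sum_univ_three, map_add, Derivation.leibniz, smul_eq_mul]
  rw [pderiv_comm 1 0 h, pderiv_comm 2 0 h, pderiv_comm 2 1 h]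
  ring

theorem derivation_pow_of_eq_self {A : Type*} [CommRing A] [Algebra F A] (D : Derivation F A A)
    {u : A} {c : F} (hu : D u = c • u) (n : ℕ) : D (u ^ n) = (n * c) • u ^ n := by
  induction n with
  | zero => simp
  | succ n ih =>
    rw [pow_succ, Derivation.leibniz, ih, hu, smul_eq_mul, smul_eq_mul]
    push_cast
    simp only [Algebra.smul_def, map_add, map_mul, map_one]
    ring

end Derivations

/-! ### Functions of `x` and `y² + z²` -/

section Embedding

variable {F : Type*} [Field F]

theorem rho_mem_ordGE : (rho : MvPowerSeries (Fin 3) F) ∈ ordGE F (Fin 3) 2 := by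
  rw [rho, pow_two, pow_two]
  exact add_mem (mul_mem_ordGE (X_mem_ordGE _) (X_mem_ordGE _))
    (mul_mem_ordGE (X_mem_ordGE _) (X_mem_ordGE _))

theorem X_rho_mem_ordGE (i : Fin 2) :
    (![X 0, rho] : Fin 2 → MvPowerSeries (Fin 3) F) i ∈ ordGE F (Fin 3) 1 := by
  fin_cases i
  · exact X_mem_ordGE _
  · exact ordGE_anti (by omega) rho_mem_ordGE

theorem hasSubst_X_rho : HasSubst (![X 0, rho] : Fin 2 → MvPowerSeries (Fin 3) F) :=
  hasSubst_of_mem_ordGE X_rho_mem_ordGE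

variable (F) in
/-- The embedding `f(x, R) ↦ f(x, y² + z²)`. -/
def emb : MvPowerSeries (Fin 2) F →ₐ[F] MvPowerSeries (Fin 3) F := substAlgHom hasSubst_X_rho

theorem emb_apply (f : MvPowerSeries (Fin 2) F) : emb F f = subst ![X 0, rho] f := by
  rw [emb, coe_substAlgHom]

@[simp] theorem emb_X_zero : emb F (X 0) = X 0 := by rw [emb, substAlgHom_X]; rfl

@[simp] theorem emb_X_one : emb F (X 1) = rho := by rw [emb, substAlgHom_X]; rfl

theorem emb_raises : Raises (emb F).toLinearMap 0 := fun n h hh => by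
  rw [AlgHom.toLinearMap_apply, emb_apply]
  exact subst_mem_ordGE hasSubst_X_rho X_rho_mem_ordGE hh

theorem emb_mem_ordGE {n : ℕ} {f : MvPowerSeries (Fin 2) F} (hf : f ∈ ordGE F (Fin 2) n) :
    emb F f ∈ ordGE F (Fin 3) n := emb_raises n f hf

/-- The exponent of `x^l R^m`. -/
def expo (l m : ℕ) : Fin 2 →₀ ℕ := Finsupp.single 0 l + Finsupp.single 1 m

@[simp] theorem expo_zero (l m : ℕ) : expo l m 0 = l := by simp [expo]

@[simp] theorem expo_one (l m : ℕ) : expo l m 1 = m := by simp [expo]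

theorem expo_eta (d : Fin 2 →₀ ℕ) : expo (d 0) (d 1) = d := by
  ext i
  fin_cases i <;> simp

theorem degree_fin_two (d : Fin 2 →₀ ℕ) : d.degree = d 0 + d 1 := by
  rw [Finsupp.degree_eq_sum, Fin.sum_univ_two]

theorem expo_inj {l m l' m' : ℕ} : expo l m = expo l' m' ↔ l = l' ∧ m = m' := by
  refine ⟨fun h => ⟨?_, ?_⟩, fun ⟨h, h'⟩ => by rw [h, h']⟩
  · simpa using DFunLike.congr_fun h 0
  · simpa using DFunLike.congr_fun h 1

theorem monomial_expo (l m : ℕ) :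
    (monomial (expo l m) (1 : F)) = X 0 ^ l * X 1 ^ m := by
  rw [X_pow_eq, X_pow_eq, monomial_mul_monomial, one_mul, expo]

theorem monomial_fin_two (d : Fin 2 →₀ ℕ) :
    (monomial d (1 : F)) = X 0 ^ d 0 * X 1 ^ d 1 := by
  rw [← monomial_expo, expo_eta]

theorem emb_monomial (d : Fin 2 →₀ ℕ) :
    emb F (monomial d 1) = X 0 ^ d 0 * rho ^ d 1 := by
  rw [monomial_fin_two, map_mul, map_pow, map_pow, emb_X_zero, emb_X_one]

/-- The coefficient of `f` at `x^l R^m` is the one of `f(x, y² + z²)` at `x^l y^(2m)`. -/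
theorem coeff_emb (f : MvPowerSeries (Fin 2) F) (d : Fin 2 →₀ ℕ) :
    coeff (Finsupp.single 0 (d 0) + Finsupp.single 1 (2 * d 1)) (emb F f) = coeff d f := by
  classical
  have key : ∀ e : Fin 2 →₀ ℕ, coeff (Finsupp.single 0 (d 0) + Finsupp.single 1 (2 * d 1))
      ((X 0 : MvPowerSeries (Fin 3) F) ^ e 0 * rho ^ e 1) = if e = d then 1 else 0 := by
    intro e
    -- The monomial in question does not involve `z`, so its coefficient can be read modulo `z`,
    -- where `y² + z²` becomes `y²`.
    have hdvd : (X 2 : MvPowerSeries (Fin 3) F) ∣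
        X 0 ^ e 0 * rho ^ e 1 - X 0 ^ e 0 * X 1 ^ (2 * e 1) := by
      rw [← mul_sub, pow_mul]
      refine Dvd.dvd.mul_left (dvd_trans ?_ (sub_dvd_pow_sub_pow _ _ _)) _
      rw [rho, add_sub_cancel_left]
      exact dvd_pow_self _ two_ne_zero
    have h0 := X_dvd_iff.mp hdvd (Finsupp.single 0 (d 0) + Finsupp.single 1 (2 * d 1)) (by simp)
    rw [map_sub, sub_eq_zero] at h0
    rw [h0, X_pow_eq, X_pow_eq, monomial_mul_monomial, one_mul, coeff_monomial]
    refine if_congr ⟨fun h => ?_, fun h => by rw [h]⟩ rfl rfl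
    have h1 := DFunLike.congr_fun h 0
    have h2 := DFunLike.congr_fun h 1
    simp at h1 h2
    ext i
    fin_cases i
    · exact h1.symm
    · exact h2.symm
  rw [emb_apply, coeff_subst hasSubst_X_rho, finsum_eq_single _ d]
  · have := key d
    rw [Finsupp.prod_fintype _ _ (by simp), Fin.prod_univ_two]
    simp only [Matrix.cons_val_zero, Matrix.cons_val_one, this, if_true, smul_eq_mul, mul_one]
  · intro e he
    have := key e
    rw [Finsupp.prod_fintype _ _ (by simp), Fin.prod_univ_two]
    simp only [Matrix.cons_val_zero, Matrix.cons_val_one, this, if_neg he, smul_zero]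

theorem emb_injective : Function.Injective (emb F) := fun f g h => by
  ext d
  rw [← coeff_emb, h, coeff_emb]

variable (F) in
/-- The Euler derivation `x ∂/∂x + R ∂/∂R`. -/
def eul : Derivation F (MvPowerSeries (Fin 2) F) (MvPowerSeries (Fin 2) F) :=
  (X 0 : MvPowerSeries (Fin 2) F) • pderiv F 0 + (X 1 : MvPowerSeries (Fin 2) F) • pderiv F 1

theorem eul_X_zero : eul F (X 0) = X 0 := by
  simp [eul]

theorem eul_X_one : eul F (X 1) = X 1 := by
  simp [eul]

theorem eul_raises : Raises (eul F).toLinearMap 0 := by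
  intro n h hh
  change X 0 * pderiv F 0 h + X 1 * pderiv F 1 h ∈ _
  cases n with
  | zero => exact mem_ordGE_zero _
  | succ n =>
    exact add_mem (ordGE_anti (by omega) (mul_mem_ordGE (X_mem_ordGE _) (pderiv_mem_ordGE _ hh)))
      (ordGE_anti (by omega) (mul_mem_ordGE (X_mem_ordGE _) (pderiv_mem_ordGE _ hh)))

theorem eul_monomial (d : Fin 2 →₀ ℕ) :
    eul F (monomial d 1) = (d.degree : F) • monomial d 1 := by
  rw [monomial_fin_two, Derivation.leibniz,
    derivation_pow_of_eq_self (eul F) (u := X 0) (c := 1) (by rw [eul_X_zero, one_smul]),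
    derivation_pow_of_eq_self (eul F) (u := X 1) (c := 1) (by rw [eul_X_one, one_smul]),
    degree_fin_two]
  push_cast
  simp only [mul_one, smul_eq_mul, mul_smul_comm, add_smul]
  rw [mul_comm (X 1 ^ d 1), add_comm]

theorem coeff_eul (f : MvPowerSeries (Fin 2) F) (d : Fin 2 →₀ ℕ) :
    coeff d (eul F f) = (d.degree : F) * coeff d f := by
  let T : Module.End F (MvPowerSeries (Fin 2) F) :=
    { toFun := fun f d => (d.degree : F) * f d
      map_add' := fun f g => funext fun d => mul_add _ (f d) (g d)
      map_smul' := fun c f => funext fun d => mul_left_comm _ c (f d) }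
  have hT : ∀ f d, coeff d (T f) = (d.degree : F) * coeff d f := fun _ _ => rfl
  have : (eul F).toLinearMap = T := by
    refine raises_ext eul_raises (fun n h hh d hd => ?_) fun e => ?_
    · rw [hT, hh d (by simpa using hd), mul_zero]
    · ext d
      classical
      rw [Derivation.coeFn_coe, eul_monomial, hT, map_smul,
        smul_eq_mul, coeff_monomial]
      split_ifs with h
      · rw [h]
      · simp
  rw [← hT, ← this]
  rfl

theorem Euler_mem_ordGE (i : Fin 3) : (Euler i : MvPowerSeries (Fin 3) F) ∈ ordGE F (Fin 3) 1 := by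
  fin_cases i
  · exact X_mem_ordGE _
  · exact Submodule.smul_mem _ _ (X_mem_ordGE _)
  · exact Submodule.smul_mem _ _ (X_mem_ordGE _)

theorem Theta_mem_ordGE (i : Fin 3) : (Theta i : MvPowerSeries (Fin 3) F) ∈ ordGE F (Fin 3) 1 := by
  fin_cases i
  · exact zero_mem _
  · exact X_mem_ordGE _
  · exact neg_mem (X_mem_ordGE _)

/-- `Theta` is the infinitesimal rotation in the `(y, z)` plane; `x` and `y² + z²` are invariants of
it. -/
theorem act_Theta_emb (f : MvPowerSeries (Fin 2) F) : act Theta (emb F f) = 0 := by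
  have h0 : actDer (Theta : VF F) (X 0) = (0 : F) • X 0 := by
    rw [actDer_apply, act_X, zero_smul]; rfl
  have h1 : actDer (Theta : VF F) rho = (0 : F) • rho := by
    rw [rho, pow_two, pow_two, map_add, Derivation.leibniz, Derivation.leibniz, actDer_apply,
      actDer_apply, act_X, act_X, zero_smul]
    simp [Theta]
    ring
  have : actLin (Theta : VF F) ∘ₗ (emb F).toLinearMap = 0 := by
    refine raises_ext (Raises.comp (actLin_raises Theta_mem_ordGE) emb_raises)
      (fun n h _ => zero_mem _) fun d => ?_
    rw [LinearMap.comp_apply, AlgHom.toLinearMap_apply, emb_monomial, actLin_apply,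
      ← actDer_apply, Derivation.leibniz, derivation_pow_of_eq_self _ h0,
      derivation_pow_of_eq_self _ h1]
    simp
  rw [← actLin_apply]
  exact LinearMap.congr_fun this f

variable [CharZero F]

/-- The factors `1/2` in `E` give `y² + z²` the eigenvalue one, the same as `x`. Hence `E` induces
the plain Euler derivation in `x` and `R`. -/
theorem act_Euler_emb (f : MvPowerSeries (Fin 2) F) :
    act Euler (emb F f) = emb F (eul F f) := by
  have h0 : actDer (Euler : VF F) (X 0) = (1 : F) • X 0 := by
    rw [actDer_apply, act_X, one_smul]; rfl
  have h1 : actDer (Euler : VF F) rho = (1 : F) • rho := by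
    rw [rho, pow_two, pow_two, map_add, Derivation.leibniz, Derivation.leibniz, actDer_apply,
      actDer_apply, act_X, act_X, one_smul]
    simp only [Euler, Matrix.cons_val_one, Matrix.cons_val_zero, Matrix.cons_val, smul_eq_mul,
      mul_smul_comm, ← add_smul]
    rw [← two_mul, mul_inv_cancel₀ two_ne_zero, one_smul, one_smul]
  have : actLin (Euler : VF F) ∘ₗ (emb F).toLinearMap
      = (emb F).toLinearMap ∘ₗ (eul F).toLinearMap := by
    refine raises_ext (Raises.comp (actLin_raises Euler_mem_ordGE) emb_raises)
      (Raises.comp emb_raises eul_raises) fun d => ?_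
    rw [LinearMap.comp_apply, LinearMap.comp_apply, AlgHom.toLinearMap_apply, emb_monomial,
      actLin_apply, ← actDer_apply, Derivation.leibniz, derivation_pow_of_eq_self _ h0,
      derivation_pow_of_eq_self _ h1]
    rw [Derivation.coeFn_coe, eul_monomial, map_smul,
      AlgHom.toLinearMap_apply, emb_monomial, degree_fin_two]
    push_cast
    simp only [mul_one, smul_eq_mul, mul_smul_comm, add_smul]
    rw [mul_comm (rho ^ d 1), add_comm]
  rw [← actLin_apply]
  exact LinearMap.congr_fun this f

end Embedding

/-! ### The Lie algebra of quasi-Eulerian fields -/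

section QuasiEulerian

variable {F : Type*} [Field F]

/-- The vector field `f(x, y² + z²) E`. -/
def psi : MvPowerSeries (Fin 2) F →ₗ[F] VF F where
  toFun f i := emb F f * Euler i
  map_add' f g := by funext i; simp [add_mul]
  map_smul' c f := by funext i; simp

theorem psi_apply (f : MvPowerSeries (Fin 2) F) (i : Fin 3) : psi f i = emb F f * Euler i := rfl

theorem psi_injective : Function.Injective (psi : MvPowerSeries (Fin 2) F → VF F) := by
  intro f g h
  refine emb_injective ?_
  have h0 : emb F f * X 0 = emb F g * X 0 := congrFun h 0
  exact mul_right_cancel₀ (fun h => by simpa [h] using coeff_index_single_self_X (R := F) (0 : Fin 3)) h0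

theorem qESum_eq_psi (β : ℕ → ℕ → F) : qESum β = psi (coeffSeries β) := by
  funext i
  rw [qESum, psi_apply, emb_apply]

theorem coeff_coeffSeries (β : ℕ → ℕ → F) (d : Fin 2 →₀ ℕ) :
    coeff d (coeffSeries β) = β (d 0) (d 0 + d 1) := rfl

theorem qE_eq_psi (l k : ℕ) : qE F l k = psi (monomial (expo l (k - l)) 1) := by
  funext i
  rw [qE, psi_apply, emb_monomial, expo_zero, expo_one]

/-- The indexing `k = l + m` matches `E^l_k` with `x^l R^m`, and excluding `l + k = 0` means a
vanishing constant term. -/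
theorem mem_QE {S : VF F} : S ∈ QE F ↔ ∃ g ∈ ordGE F (Fin 2) 1, S = psi g := by
  constructor
  · rintro ⟨β, h0, rfl⟩
    exact ⟨_, mem_ordGE_one.mpr (by rw [coeff_coeffSeries]; simpa using h0), qESum_eq_psi β⟩
  · rintro ⟨g, hg, rfl⟩
    refine ⟨fun l k => coeff (expo l (k - l)) g, ?_, ?_⟩
    · have : expo 0 0 = 0 := by simp [expo]
      simpa [this] using mem_ordGE_one.mp hg
    · rw [qESum_eq_psi]
      congr 1
      ext d
      rw [coeff_coeffSeries, Nat.add_sub_cancel_left, expo_eta]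

theorem act_psi (g : MvPowerSeries (Fin 2) F) (h : MvPowerSeries (Fin 3) F) :
    act (psi g) h = emb F g * act Euler h := by
  simp only [act, psi_apply, Finset.mul_sum, mul_assoc]

theorem psi_mem_ordGE {k : ℕ} {g : MvPowerSeries (Fin 2) F} (hg : g ∈ ordGE F (Fin 2) k)
    (i : Fin 3) : psi g i ∈ ordGE F (Fin 3) (k + 1) :=
  mul_mem_ordGE (emb_mem_ordGE hg) (Euler_mem_ordGE i)

theorem act_add (v w : VF F) (h : MvPowerSeries (Fin 3) F) :
    act (v + w) h = act v h + act w h := by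
  simp only [act, Pi.add_apply, add_mul, Finset.sum_add_distrib]

theorem bracket_add_right (a v w : VF F) : bracket a (v + w) = bracket a v + bracket a w := by
  funext i
  simp only [bracket, Pi.add_apply, act_add]
  rw [← actLin_apply a (v i + w i), map_add, actLin_apply, actLin_apply]
  ring

/-- The bracket `{g, f} = g N(f) - f N(g)`, where `N` is the Euler derivation. -/
def brk (g f : MvPowerSeries (Fin 2) F) : MvPowerSeries (Fin 2) F := g * eul F f - f * eul F g

/-- The bracket as a bilinear map. -/
def ad : MvPowerSeries (Fin 2) F →ₗ[F] Module.End F (MvPowerSeries (Fin 2) F) :=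
  LinearMap.mk₂ F brk
    (fun a b c => by simp only [brk, map_add]; ring)
    (fun r a b => by simp only [brk, Derivation.map_smul, smul_mul_assoc, mul_smul_comm, smul_sub])
    (fun a b c => by simp only [brk, map_add]; ring)
    (fun r a b => by simp only [brk, Derivation.map_smul, smul_mul_assoc, mul_smul_comm, smul_sub])

theorem ad_apply (g f : MvPowerSeries (Fin 2) F) : ad g f = g * eul F f - f * eul F g := rfl

theorem ad_self (f : MvPowerSeries (Fin 2) F) : ad f f = 0 := sub_self _

theorem ad_mem_ordGE {m n : ℕ} {g f : MvPowerSeries (Fin 2) F} (hg : g ∈ ordGE F (Fin 2) m)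
    (hf : f ∈ ordGE F (Fin 2) n) : ad g f ∈ ordGE F (Fin 2) (m + n) := by
  rw [ad_apply]
  refine sub_mem (mul_mem_ordGE hg (eul_raises n f hf)) ?_
  rw [add_comm m n]
  exact mul_mem_ordGE hf (eul_raises m g hg)

theorem ad_raises {k : ℕ} {g : MvPowerSeries (Fin 2) F} (hg : g ∈ ordGE F (Fin 2) k) :
    Raises (ad g) k := fun n f hf => by
  rw [add_comm]; exact ad_mem_ordGE hg hf

theorem bracket_Euler_Theta : bracket (Euler : VF F) Theta = 0 := by
  funext i
  have hs : ∀ (v : VF F) (c : F) (h : MvPowerSeries (Fin 3) F), act v (c • h) = c • act v h :=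
    fun v c h => by rw [← actLin_apply, map_smul, actLin_apply]
  have hn : ∀ (v : VF F) (h : MvPowerSeries (Fin 3) F), act v (-h) = -act v h :=
    fun v h => by rw [← actLin_apply, map_neg, actLin_apply]
  have h0 : act (Euler : VF F) 0 = 0 := by rw [← actLin_apply, map_zero]
  rw [bracket]
  fin_cases i
  · change act Euler 0 - act Theta (X 0) = 0
    rw [h0, act_X]
    exact sub_zero _
  · change act Euler (X 2) - act Theta ((2⁻¹ : F) • X 1) = 0
    rw [act_X, hs, act_X]
    exact sub_self _
  · change act Euler (-X 1) - act Theta ((2⁻¹ : F) • X 2) = 0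
    rw [hn, act_X, hs, act_X]
    change -((2⁻¹ : F) • X 1) - (2⁻¹ : F) • -X 1 = 0
    simp

theorem act_Euler_act_Theta (h : MvPowerSeries (Fin 3) F) :
    act Euler (act Theta h) = act Theta (act Euler h) := by
  have := act_bracket Euler Theta h
  rw [bracket_Euler_Theta] at this
  have h0 : act (0 : VF F) h = 0 := by simp [act]
  rw [h0] at this
  exact (sub_eq_zero.mp this.symm)

theorem act_psi_act_Theta (g : MvPowerSeries (Fin 2) F) (h : MvPowerSeries (Fin 3) F) :
    act (psi g) (act Theta h) = act Theta (act (psi g) h) := by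
  rw [act_psi, act_psi, act_mul, act_Theta_emb, act_Euler_act_Theta]
  ring

/-- `Theta` kills the coefficient function and commutes with `E`. So it is carried along unchanged
by every permissible transformation. -/
theorem bracket_psi_Theta (g : MvPowerSeries (Fin 2) F) : bracket (psi g) Theta = 0 := by
  funext i
  rw [bracket, ← act_X Theta i, act_psi_act_Theta, act_X]
  exact sub_self _

/-- The terms containing `E` applied twice cancel; what remains are the derivatives of the
coefficient functions along `E`, given by `eul`. -/
theorem bracket_psi [CharZero F] (g f : MvPowerSeries (Fin 2) F) : bracket (psi g) (psi f) = psi (ad g f) := by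
  funext i
  rw [bracket, psi_apply, psi_apply, psi_apply, act_psi, act_psi, act_mul, act_mul,
    act_Euler_emb, act_Euler_emb, ad_apply, map_sub, map_mul, map_mul]
  ring

end QuasiEulerian

/-! ### Time-one flows, their action on vector fields, and their composition -/

section Flow

variable {F : Type*} [Field F]

theorem timeOneFlow_eq_expMap (S : VF F) (i : Fin 3) :
    timeOneFlow S i = expMap (actLin S) (X i) := by
  have : ⇑(actLin S) = act S := funext fun h => actLin_apply S h
  ext d
  rw [coeff_expMap]
  simp only [Module.End.pow_apply, this]
  rfl

/-- A transformation close to the identity determines the transformed vector field. -/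
theorem eq_of_act_timeOneFlow {S v w : VF F} (hS : ∀ i, S i ∈ ordGE F (Fin 3) 2)
    (h : ∀ i, act v (timeOneFlow S i) = act w (timeOneFlow S i)) : v = w := by
  have key : ∀ n i, v i - w i ∈ ordGE F (Fin 3) n := by
    intro n
    induction n with
    | zero => exact fun i => mem_ordGE_zero _
    | succ n ih =>
      intro i
      have h1 : act (v - w) (timeOneFlow S i) = 0 := by
        have := h i
        simp only [act, Pi.sub_apply, sub_mul, Finset.sum_sub_distrib] at this ⊢
        rw [this, sub_self]
      -- The difference field kills the flow components. Since these differ from the coordinates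
      -- only in order two, the order of the difference improves by one.
      have h2 : v i - w i = -act (v - w) (timeOneFlow S i - X i) := by
        rw [← actLin_apply, map_sub, actLin_apply, actLin_apply, h1, act_X, zero_sub, neg_neg]
        rfl
      rw [h2, act]
      refine neg_mem (Submodule.sum_mem _ fun j _ => mul_mem_ordGE (ih j) (pderiv_mem_ordGE j ?_))
      rw [timeOneFlow_eq_expMap]
      exact expMap_raises_sub (actLin_raises hS) (X_mem_ordGE i)
  funext i
  exact eq_of_forall_sub_mem_ordGE fun n => key n i

/-- The operator `h ↦ g (N + a) h`. -/
def shiftOp (a : F) (g : MvPowerSeries (Fin 2) F) : Module.End F (MvPowerSeries (Fin 2) F) where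
  toFun h := g * (eul F h + a • h)
  map_add' h k := by rw [map_add, smul_add]; ring
  map_smul' c h := by
    rw [Derivation.map_smul, smul_comm a c, ← smul_add, mul_smul_comm, RingHom.id_apply]

theorem shiftOp_apply (a : F) (g h : MvPowerSeries (Fin 2) F) :
    shiftOp a g h = g * (eul F h + a • h) := rfl

theorem shiftOp_add (a : F) (g g' : MvPowerSeries (Fin 2) F) :
    shiftOp a (g + g') = shiftOp a g + shiftOp a g' := by
  ext1 h
  simp only [shiftOp_apply, LinearMap.add_apply, add_mul]

theorem shiftOp_raises (a : F) {k : ℕ} {g : MvPowerSeries (Fin 2) F}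
    (hg : g ∈ ordGE F (Fin 2) k) : Raises (shiftOp a g) k := fun n h hh => by
  rw [add_comm n k]
  exact mul_mem_ordGE hg (add_mem (eul_raises n h hh) (Submodule.smul_mem _ _ hh))

/-- Solved degree by degree: a correction `δ` of `g` changes the value at `1` by `δ (N + a) 1 = a δ`
to leading order, so the current error divided by `-a` is the right correction. This replaces the
Baker–Campbell–Hausdorff formula in composing flows. -/
theorem exists_expMap_shiftOp_eq {a : F} (ha : a ≠ 0) {V : MvPowerSeries (Fin 2) F}
    (hV : V - 1 ∈ ordGE F (Fin 2) 1) :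
    ∃ g ∈ ordGE F (Fin 2) 1, expMap (shiftOp a g) 1 = V := by
  obtain ⟨g, -, hg⟩ := exists_forall_of_step
    (P := fun k g => g ∈ ordGE F (Fin 2) 1 ∧ expMap (shiftOp a g) 1 - V ∈ ordGE F (Fin 2) k)
    (M := 1) (g₀ := 0) ⟨zero_mem _, by
      rw [expMap_of_map_eq_zero (by rw [shiftOp_apply, zero_mul]), ← neg_mem_iff, neg_sub]
      exact hV⟩
    (fun k hk g g' hgg' ⟨h1, h2⟩ => by
      have hg' : g' = g + (g' - g) := by ring
      refine ⟨?_, ?_⟩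
      · rw [hg']; exact add_mem h1 (ordGE_anti hk hgg')
      · have := expMap_add_sub_mem (shiftOp_raises a h1) hk (shiftOp_raises a hgg')
          (mem_ordGE_zero 1)
        rw [← shiftOp_add, ← hg', zero_add] at this
        have := add_mem this h2
        convert this using 1
        ring)
    (fun k hk g ⟨h1, h2⟩ => by
      have hδ : -(a⁻¹ • (expMap (shiftOp a g) 1 - V)) ∈ ordGE F (Fin 2) k :=
        neg_mem (Submodule.smul_mem _ _ h2)
      refine ⟨_, hδ, add_mem h1 (ordGE_anti hk hδ), ?_⟩
      have := expMap_add_sub (shiftOp_raises a h1) hk (shiftOp_raises a hδ) (mem_ordGE_zero 1)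
      rw [← shiftOp_add, zero_add] at this
      convert this using 1
      rw [shiftOp_apply, Derivation.map_one_eq_zero, zero_add, mul_smul_comm, mul_one, smul_neg,
        smul_smul, mul_inv_cancel₀ ha, one_smul]
      ring)
  exact ⟨g, (hg 1 le_rfl).1, eq_of_forall_sub_mem_ordGE fun n =>
    ordGE_anti (Nat.le_succ n) (hg (n + 1) (by omega)).2⟩

variable [CharZero F]

/-- The algebra automorphism `exp(S)`. -/
def expAlg (S : VF F) (hS : ∀ i, S i ∈ ordGE F (Fin 3) 2) :
    MvPowerSeries (Fin 3) F →ₐ[F] MvPowerSeries (Fin 3) F :=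
  AlgHom.ofLinearMap (expLin (actLin S))
    (expMap_of_map_eq_zero (by rw [actLin, Derivation.coeFn_coe, Derivation.map_one_eq_zero]))
    (fun a b => expMap_bilin (actLin_raises hS) (actLin_raises hS) (actLin_raises hS)
      (LinearMap.mul F _) (fun _ _ _ ha _ hb => mul_mem_ordGE ha hb)
      (fun a b => by simp only [LinearMap.mul_apply_apply, actLin_apply, act_mul]) a b)

theorem expAlg_apply (S : VF F) (hS : ∀ i, S i ∈ ordGE F (Fin 3) 2)
    (h : MvPowerSeries (Fin 3) F) : expAlg S hS h = expMap (actLin S) h := rfl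

theorem expAlg_raises (S : VF F) (hS : ∀ i, S i ∈ ordGE F (Fin 3) 2) :
    Raises (expAlg S hS).toLinearMap 0 := fun _ _ hh => expMap_mem_ordGE (actLin_raises hS) hh

/-- Composition with the time-one flow of `S` is `exp(S)`. -/
theorem subst_timeOneFlow {S : VF F} (hS : ∀ i, S i ∈ ordGE F (Fin 3) 2)
    (h : MvPowerSeries (Fin 3) F) : subst (timeOneFlow S) h = expMap (actLin S) h := by
  have : timeOneFlow S = fun i => expAlg S hS (X i) :=
    funext fun i => timeOneFlow_eq_expMap S i
  rw [this, subst_eq_algHom _ (expAlg_raises S hS), expAlg_apply]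

/-- The pairing `(f, h) ↦ f E(h)` satisfies the Leibniz rule with `ad g` on the first factor and the
action of `gE` on the second; this is the definition of the bracket rearranged. Exponentiating gives
the conjugation formula, while the `Theta` part commutes with `gE`. -/
theorem expMap_act_psi {g : MvPowerSeries (Fin 2) F} (hg : g ∈ ordGE F (Fin 2) 1)
    (f : MvPowerSeries (Fin 2) F) (h : MvPowerSeries (Fin 3) F) :
    expMap (actLin (psi g)) (act (Theta + psi f) h)
      = act (Theta + psi (expMap (ad g) f)) (expMap (actLin (psi g)) h) := by
  have hr : Raises (actLin (psi g)) 1 := actLin_raises (psi_mem_ordGE hg)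
  rw [act_add, expMap_add, act_add]
  congr 1
  · rw [← actLin_apply, ← actLin_apply]
    refine expMap_comm hr (actLin_raises Theta_mem_ordGE) (fun k => ?_) h
    simp only [actLin_apply, act_psi_act_Theta]
  · let μ : MvPowerSeries (Fin 2) F →ₗ[F] MvPowerSeries (Fin 3) F →ₗ[F] MvPowerSeries (Fin 3) F :=
      (LinearMap.mul F (MvPowerSeries (Fin 3) F)).compl₁₂ (emb F).toLinearMap
        (actLin (Euler : VF F))
    have hμ : ∀ a b, μ a b = act (psi a) b := fun a b => by
      rw [act_psi, ← actLin_apply]; rfl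
    rw [← hμ, ← hμ]
    refine expMap_bilin (ad_raises hg) hr hr μ (fun m n a ha b hb => ?_) (fun a b => ?_) f h
    · exact mul_mem_ordGE (emb_mem_ordGE ha) (actLin_raises Euler_mem_ordGE n b hb)
    · rw [hμ, hμ, hμ, actLin_apply, actLin_apply, ← bracket_psi, act_bracket]
      ring

/-- The flow of `psi g` transforms `Θ⁰₀ + psi f` into `Θ⁰₀ + exp(ad g) f` and into nothing else. -/
theorem transforms_timeOneFlow_iff {g f f' : MvPowerSeries (Fin 2) F}
    (hg : g ∈ ordGE F (Fin 2) 1) :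
    Transforms (timeOneFlow (psi g)) (Theta + psi f) (Theta + psi f') ↔
      f' = expMap (ad g) f := by
  have hS : ∀ i, psi g i ∈ ordGE F (Fin 3) 2 := psi_mem_ordGE hg
  have key : ∀ i, subst (timeOneFlow (psi g)) ((Theta + psi f : VF F) i)
      = act (Theta + psi (expMap (ad g) f)) (timeOneFlow (psi g) i) := fun i => by
    rw [subst_timeOneFlow hS, timeOneFlow_eq_expMap, ← expMap_act_psi hg, act_X]
  constructor
  · intro h
    have := eq_of_act_timeOneFlow hS fun i => (h i).trans (key i)
    exact psi_injective (add_left_cancel this)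
  · rintro rfl i
    exact (key i).symm

/-- `N + (a + b)` acts on a product like `N + a` on the first factor plus `N + b` on the second. -/
theorem expMap_shiftOp_mul {g : MvPowerSeries (Fin 2) F} (hg : g ∈ ordGE F (Fin 2) 1)
    (a b : F) (p q : MvPowerSeries (Fin 2) F) :
    expMap (shiftOp (a + b) g) (p * q)
      = expMap (shiftOp a g) p * expMap (shiftOp b g) q := by
  refine expMap_bilin (shiftOp_raises a hg) (shiftOp_raises b hg) (shiftOp_raises _ hg)
    (LinearMap.mul F _) (fun _ _ _ ha _ hb => mul_mem_ordGE ha hb) (fun p q => ?_) p q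
  simp only [LinearMap.mul_apply_apply, shiftOp_apply, Derivation.leibniz, smul_eq_mul,
    smul_eq_C_mul, map_add]
  ring

/-- Each coordinate is an eigenvector of `E`, so pulling it out of the flow only shifts `N` by the
eigenvalue. A flow is thus multiplication of each coordinate by a function of `x` and `R`. -/
theorem expMap_X_mul_emb {g : MvPowerSeries (Fin 2) F} (hg : g ∈ ordGE F (Fin 2) 1)
    (i : Fin 3) (a : F) (hi : act Euler (X i) = a • (X i : MvPowerSeries (Fin 3) F))
    (h : MvPowerSeries (Fin 2) F) :
    expMap (actLin (psi g)) (X i * emb F h) = X i * emb F (expMap (shiftOp a g) h) := by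
  refine expMap_intertwine (shiftOp_raises a hg) (actLin_raises (psi_mem_ordGE hg))
    (T := LinearMap.mulLeft F (X i) ∘ₗ (emb F).toLinearMap) (fun n k hk => ?_) (fun k => ?_) h
  · exact ordGE_anti (by omega) (mul_mem_ordGE (X_mem_ordGE i) (emb_mem_ordGE hk))
  · simp only [LinearMap.comp_apply, LinearMap.mulLeft_apply, AlgHom.toLinearMap_apply,
      actLin_apply, act_psi, act_mul, hi, act_Euler_emb, shiftOp_apply, map_mul, map_add,
      map_smul]
    simp only [smul_eq_C_mul]
    ring

/-- The eigenvalue one of `x` is written as `2⁻¹ + 2⁻¹` so that the multiplier of `x` becomes the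
square of that of `y` and `z`. -/
theorem act_Euler_X (i : Fin 3) : ∃ a : F, (a = 2⁻¹ ∨ a = 2⁻¹ + 2⁻¹) ∧
    act Euler (X i) = a • (X i : MvPowerSeries (Fin 3) F) := by
  rw [act_X]
  fin_cases i
  · refine ⟨_, Or.inr rfl, ?_⟩
    rw [← two_mul, mul_inv_cancel₀ two_ne_zero, one_smul]
    rfl
  · exact ⟨_, Or.inl rfl, rfl⟩
  · exact ⟨_, Or.inl rfl, rfl⟩

/-- The composition of two permissible transformations is permissible. -/
theorem exists_expMap_comp {g₁ g₂ : MvPowerSeries (Fin 2) F} (h₁ : g₁ ∈ ordGE F (Fin 2) 1)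
    (h₂ : g₂ ∈ ordGE F (Fin 2) 1) : ∃ g ∈ ordGE F (Fin 2) 1, ∀ h,
    expMap (actLin (psi g)) h = expMap (actLin (psi g₁)) (expMap (actLin (psi g₂)) h) := by
  have hc : (2⁻¹ : F) ≠ 0 := inv_ne_zero two_ne_zero
  -- `V` is the factor by which the composition multiplies `y` and `z`. Matching it also matches
  -- `x`, whose factor is the square, and then all functions, both sides being substitutions.
  obtain ⟨g, hg, hgV⟩ := exists_expMap_shiftOp_eq hc
    (V := expMap (shiftOp 2⁻¹ g₁) (expMap (shiftOp 2⁻¹ g₂) 1)) (by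
      have e1 := expMap_raises_sub (shiftOp_raises (2⁻¹ : F) h₂) (mem_ordGE_zero 1)
      have e2 := expMap_raises_sub (shiftOp_raises (2⁻¹ : F) h₁)
        (mem_ordGE_zero (expMap (shiftOp 2⁻¹ g₂) 1))
      have := add_mem e2 e1
      convert this using 1
      ring)
  refine ⟨g, hg, fun h => ?_⟩
  have hX : ∀ i, expMap (actLin (psi g)) (X i)
      = expMap (actLin (psi g₁)) (expMap (actLin (psi g₂)) (X i)) := by
    intro i
    obtain ⟨a, ha, hi⟩ := act_Euler_X (F := F) i
    have e : (X i : MvPowerSeries (Fin 3) F) = X i * emb F 1 := by rw [map_one, mul_one]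
    rw [e, expMap_X_mul_emb hg i a hi, expMap_X_mul_emb h₂ i a hi, expMap_X_mul_emb h₁ i a hi]
    congr 2
    rcases ha with rfl | rfl
    · exact hgV
    · rw [← one_mul (1 : MvPowerSeries (Fin 2) F), expMap_shiftOp_mul hg, expMap_shiftOp_mul h₂,
        expMap_shiftOp_mul h₁, hgV]
  have hflow : timeOneFlow (psi g) = fun i => (expAlg (psi g₁) (psi_mem_ordGE h₁)).comp
      (expAlg (psi g₂) (psi_mem_ordGE h₂)) (X i) := by
    funext i
    rw [timeOneFlow_eq_expMap, hX, AlgHom.comp_apply, expAlg_apply, expAlg_apply]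
  have hr : Raises ((expAlg (psi g₁) (psi_mem_ordGE h₁)).comp
      (expAlg (psi g₂) (psi_mem_ordGE h₂))).toLinearMap 0 := fun n k hk =>
    expMap_mem_ordGE (actLin_raises (psi_mem_ordGE h₁))
      (expMap_mem_ordGE (actLin_raises (psi_mem_ordGE h₂)) hk)
  rw [← subst_timeOneFlow (psi_mem_ordGE hg), hflow, subst_eq_algHom _ hr, AlgHom.comp_apply,
    expAlg_apply, expAlg_apply]

/-- `Θ⁰₀ + psi f` can be sent into `Θ⁰₀ + psi f'` by a permissible transformation. -/
def FlowEquiv (f f' : MvPowerSeries (Fin 2) F) : Prop :=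
  ∃ g ∈ ordGE F (Fin 2) 1, ∀ h, expMap (actLin (psi g)) (act (Theta + psi f) h)
    = act (Theta + psi f') (expMap (actLin (psi g)) h)

theorem flowEquiv_expMap {g : MvPowerSeries (Fin 2) F} (hg : g ∈ ordGE F (Fin 2) 1)
    (f : MvPowerSeries (Fin 2) F) : FlowEquiv f (expMap (ad g) f) :=
  ⟨g, hg, expMap_act_psi hg f⟩

theorem FlowEquiv.trans {f₁ f₂ f₃ : MvPowerSeries (Fin 2) F} (h : FlowEquiv f₁ f₂)
    (h' : FlowEquiv f₂ f₃) : FlowEquiv f₁ f₃ := by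
  obtain ⟨g, hg, hc⟩ := h
  obtain ⟨g', hg', hc'⟩ := h'
  obtain ⟨k, hk, hkc⟩ := exists_expMap_comp hg' hg
  exact ⟨k, hk, fun h => by rw [hkc, hkc, hc, hc']⟩

theorem FlowEquiv.exists_transforms {f f' : MvPowerSeries (Fin 2) F} (h : FlowEquiv f f') :
    ∃ φ, IsPermissible φ ∧ Transforms φ (Theta + psi f) (Theta + psi f') := by
  obtain ⟨g, hg, hc⟩ := h
  refine ⟨timeOneFlow (psi g), ⟨psi g, mem_QE.mpr ⟨g, hg, rfl⟩, rfl⟩, fun i => ?_⟩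
  rw [subst_timeOneFlow (psi_mem_ordGE hg), timeOneFlow_eq_expMap, ← hc, act_X]

end Flow

/-! ### Division by the linear part, and the leading term of a bracket -/

section Division

variable {F : Type*} [Field F]

@[simp] theorem degree_expo (l m : ℕ) : (expo l m).degree = l + m := by
  rw [degree_fin_two, expo_zero, expo_one]

theorem mem_ordGE_iff_expo {n : ℕ} {h : MvPowerSeries (Fin 2) F} :
    h ∈ ordGE F (Fin 2) n ↔ ∀ l m, l + m < n → coeff (expo l m) h = 0 := by
  refine ⟨fun hh l m hlm => hh _ (by simpa using hlm), fun hh d hd => ?_⟩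
  rw [← expo_eta d]
  exact hh _ _ (by rwa [degree_fin_two] at hd)

theorem ext_expo {g h : MvPowerSeries (Fin 2) F}
    (H : ∀ l m, coeff (expo l m) g = coeff (expo l m) h) : g = h := by
  ext d
  rw [← expo_eta d]
  exact H _ _

theorem coeff_X_zero_mul_succ (l m : ℕ) (h : MvPowerSeries (Fin 2) F) :
    coeff (expo (l + 1) m) (X 0 * h) = coeff (expo l m) h := by
  have : expo (l + 1) m = Finsupp.single 0 1 + expo l m := by
    ext i; fin_cases i <;> simp [add_comm]
  rw [this, X_def, coeff_add_monomial_mul, one_mul]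

theorem coeff_X_one_mul_succ (l m : ℕ) (h : MvPowerSeries (Fin 2) F) :
    coeff (expo l (m + 1)) (X 1 * h) = coeff (expo l m) h := by
  have : expo l (m + 1) = Finsupp.single 1 1 + expo l m := by
    ext i; fin_cases i <;> simp [add_comm]
  rw [this, X_def, coeff_add_monomial_mul, one_mul]

theorem coeff_X_one_mul_zero (l : ℕ) (h : MvPowerSeries (Fin 2) F) :
    coeff (expo l 0) (X 1 * h) = 0 :=
  X_dvd_iff.mp (dvd_mul_right (X 1) h) _ (expo_one _ _)

/-- The linear form `a x + b R`. -/
def linForm (a b : F) : MvPowerSeries (Fin 2) F := a • X 0 + b • X 1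

theorem linForm_mem_ordGE (a b : F) : linForm a b ∈ ordGE F (Fin 2) 1 :=
  add_mem (Submodule.smul_mem _ _ (X_mem_ordGE _)) (Submodule.smul_mem _ _ (X_mem_ordGE _))

theorem eul_linForm (a b : F) : eul F (linForm a b) = linForm a b := by
  rw [linForm, map_add, Derivation.map_smul, Derivation.map_smul, eul_X_zero, eul_X_one]

theorem coeff_linForm_mul_zero (a b : F) (l : ℕ) (h : MvPowerSeries (Fin 2) F) :
    coeff (expo (l + 1) 0) (linForm a b * h) = a * coeff (expo l 0) h := by
  rw [linForm, add_mul, smul_mul_assoc, smul_mul_assoc, map_add, map_smul, map_smul,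
    coeff_X_zero_mul_succ, coeff_X_one_mul_zero, smul_zero, add_zero, smul_eq_mul]

theorem coeff_linForm_mul_succ (a b : F) (l m : ℕ) (h : MvPowerSeries (Fin 2) F) :
    coeff (expo (l + 1) (m + 1)) (linForm a b * h)
      = a * coeff (expo l (m + 1)) h + b * coeff (expo (l + 1) m) h := by
  rw [linForm, add_mul, smul_mul_assoc, smul_mul_assoc, map_add, map_smul, map_smul,
    coeff_X_zero_mul_succ, coeff_X_one_mul_succ, smul_eq_mul, smul_eq_mul]

/-- The coefficient at `x^l R^m` of the quotient of `p` by `a x + b R` modulo pure powers of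
`R`. -/
def divCoeff (a b : F) (p : MvPowerSeries (Fin 2) F) : ℕ → ℕ → F
  | 0, l => a⁻¹ * coeff (expo (l + 1) 0) p
  | m + 1, l => a⁻¹ * (coeff (expo (l + 1) (m + 1)) p - b * divCoeff a b p m (l + 1))

/-- The coefficient of `(a x + b R) δ` at `x^(l+1) R^m` is `a δ_(l,m) + b δ_(l+1,m-1)`, so the
system is triangular in the exponent of `R` and solvable as `a ≠ 0`. -/
theorem exists_linForm_mul_eq {a : F} (ha : a ≠ 0) (b : F) {k : ℕ} {p : MvPowerSeries (Fin 2) F}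
    (hp : p ∈ ordGE F (Fin 2) (k + 1)) : ∃ δ ∈ ordGE F (Fin 2) k, ∀ l m,
    coeff (expo (l + 1) m) (linForm a b * δ) = coeff (expo (l + 1) m) p := by
  let δ : MvPowerSeries (Fin 2) F := fun d => divCoeff a b p (d 1) (d 0)
  have hδ : ∀ l m, coeff (expo l m) δ = divCoeff a b p m l := fun l m => by
    change divCoeff a b p (expo l m 1) (expo l m 0) = _
    rw [expo_zero, expo_one]
  rw [mem_ordGE_iff_expo] at hp
  refine ⟨δ, mem_ordGE_iff_expo.mpr fun l m => ?_, fun l m => ?_⟩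
  · rw [hδ]
    induction m generalizing l with
    | zero => intro h; rw [divCoeff, hp _ _ (by omega), mul_zero]
    | succ m ih =>
      intro h
      rw [divCoeff, hp _ _ (by omega), ih _ (by omega), mul_zero, sub_zero, mul_zero]
  · cases m with
    | zero => rw [coeff_linForm_mul_zero, hδ, divCoeff, mul_inv_cancel_left₀ ha]
    | succ m =>
      rw [coeff_linForm_mul_succ, hδ, hδ, divCoeff, mul_inv_cancel_left₀ ha, sub_add_cancel]

/-- The uniqueness half of the same triangular system: in degree `k`, the coefficients of `δ` vanish
one after another as the exponent of `R` increases. -/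
theorem mem_ordGE_of_linForm_mul {a : F} (ha : a ≠ 0) (b : F) {k : ℕ}
    {δ : MvPowerSeries (Fin 2) F} (hδ : δ ∈ ordGE F (Fin 2) k)
    (h : ∀ l m, l + m = k → coeff (expo (l + 1) m) (linForm a b * δ) = 0) :
    δ ∈ ordGE F (Fin 2) (k + 1) := by
  have key : ∀ m l, l + m = k → coeff (expo l m) δ = 0 := by
    intro m
    induction m with
    | zero =>
      intro l hl
      have := h l 0 hl
      rw [coeff_linForm_mul_zero] at this
      exact (mul_eq_zero.mp this).resolve_left ha
    | succ m ih =>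
      intro l hl
      have := h l (m + 1) hl
      rw [coeff_linForm_mul_succ, ih (l + 1) (by omega), mul_zero, add_zero] at this
      exact (mul_eq_zero.mp this).resolve_left ha
  rw [mem_ordGE_iff_expo]
  intro l m hlm
  rcases Nat.lt_succ_iff_lt_or_eq.mp hlm with h' | h'
  · exact mem_ordGE_iff_expo.mp hδ l m h'
  · exact key m l h'

theorem eul_sub_mem_ordGE {k : ℕ} {δ : MvPowerSeries (Fin 2) F} (hδ : δ ∈ ordGE F (Fin 2) k) :
    eul F δ - (k : F) • δ ∈ ordGE F (Fin 2) (k + 1) := by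
  intro d hd
  rw [map_sub, map_smul, coeff_eul, smul_eq_mul, ← sub_mul]
  rcases Nat.lt_succ_iff_lt_or_eq.mp hd with h' | h'
  · rw [hδ d h', mul_zero]
  · rw [h', sub_self, zero_mul]

/-- The leading part of a bracket with a vector field with linear part `a x + b R`. -/
theorem ad_sub_mem_ordGE {a b : F} {k : ℕ} {δ f : MvPowerSeries (Fin 2) F}
    (hδ : δ ∈ ordGE F (Fin 2) k) (hf : f - linForm a b ∈ ordGE F (Fin 2) 2) :
    ad δ f - (1 - k : F) • (linForm a b * δ) ∈ ordGE F (Fin 2) (k + 2) := by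
  have e : ad δ f - (1 - k : F) • (linForm a b * δ)
      = δ * eul F (f - linForm a b) - (f - linForm a b) * eul F δ
        - linForm a b * (eul F δ - (k : F) • δ) := by
    rw [ad_apply, map_sub, eul_linForm, sub_smul, one_smul, mul_sub (linForm a b),
      mul_smul_comm]
    ring
  rw [e]
  refine sub_mem (sub_mem (mul_mem_ordGE hδ (eul_raises 2 _ hf)) ?_) ?_
  · rw [add_comm]; exact mul_mem_ordGE hf (eul_raises k δ hδ)
  · exact ordGE_anti (by omega) (mul_mem_ordGE (linForm_mem_ordGE a b) (eul_sub_mem_ordGE hδ))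

/-- The case `k = 1` of the leading-term formula, where the factor `1 - k` is zero. This is why the
terms of degree at most two survive in every normal form. -/
theorem ad_mem_ordGE_three {a b : F} {g f : MvPowerSeries (Fin 2) F}
    (hg : g ∈ ordGE F (Fin 2) 1) (hf : f - linForm a b ∈ ordGE F (Fin 2) 2) :
    ad g f ∈ ordGE F (Fin 2) 3 := by
  simpa using ad_sub_mem_ordGE hg hf

theorem mem_ordGE_one_of_sub_linForm {a b : F} {f : MvPowerSeries (Fin 2) F}
    (hf : f - linForm a b ∈ ordGE F (Fin 2) 2) : f ∈ ordGE F (Fin 2) 1 := by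
  have := add_mem (ordGE_anti one_le_two hf) (linForm_mem_ordGE a b)
  simpa using this

theorem homogeneousComponent_mem_ordGE {σ : Type*} (k : ℕ) (p : MvPowerSeries σ F) :
    homogeneousComponent k p ∈ ordGE F σ k := fun d hd => by
  rw [coeff_homogeneousComponent, if_neg (by omega)]

end Division

/-! ### Elimination of the higher terms divisible by `x` -/

section NormalForm

variable {F : Type*} [Field F] [CharZero F]

/-- All terms of degree greater than `M` except for the powers of `R` can be eliminated by a
transformation that does not change the terms of degree at most `M`. -/
theorem exists_ad_normalize {a b : F} (ha : a ≠ 0) {M : ℕ} (hM : 2 ≤ M)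
    {f : MvPowerSeries (Fin 2) F} (hf : f - linForm a b ∈ ordGE F (Fin 2) 2) :
    ∃ g ∈ ordGE F (Fin 2) M, expMap (ad g) f - f ∈ ordGE F (Fin 2) (M + 1) ∧
      ∀ l m, M < l + 1 + m → coeff (expo (l + 1) m) (expMap (ad g) f) = 0 := by
  have hf1 := mem_ordGE_one_of_sub_linForm hf
  have hr : ∀ g ∈ ordGE F (Fin 2) M, Raises (ad g) 1 := fun g hg =>
    (ad_raises hg).mono (by omega)
  obtain ⟨g, -, hg⟩ := exists_forall_of_step
    (P := fun k g => g ∈ ordGE F (Fin 2) M ∧ ∀ l m, M < l + 1 + m → l + 1 + m ≤ k →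
      coeff (expo (l + 1) m) (expMap (ad g) f) = 0)
    (M := M) (g₀ := 0) ⟨zero_mem _, fun l m h1 h2 => absurd h1 (by omega)⟩
    (fun k hk g g' hgg' ⟨h1, h2⟩ => by
      have hg' : g' = g + (g' - g) := by ring
      refine ⟨?_, fun l m hlm hlk => ?_⟩
      · rw [hg']; exact add_mem h1 (ordGE_anti hk hgg')
      · have := expMap_add_sub_mem (hr g h1) (by omega) (ad_raises hgg') hf1
        rw [← map_add, ← hg'] at this
        have h0 := mem_ordGE_iff_expo.mp this (l + 1) m (by omega)
        rw [map_sub, h2 l m hlm hlk, sub_zero] at h0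
        exact h0)
    (fun k hk g ⟨h1, h2⟩ => by
      obtain ⟨δ₀, hδ₀, hdiv⟩ := exists_linForm_mul_eq ha b
        (homogeneousComponent_mem_ordGE (k + 1) (expMap (ad g) f))
      -- Here `k ≥ M ≥ 2`; this is where linear generators are excluded.
      have hk1 : (1 - k : F) ≠ 0 := by
        rw [sub_ne_zero]
        exact_mod_cast (by omega : 1 ≠ k)
      -- The correction is scaled so that its leading bracket cancels the part of degree `k + 1` up
      -- to a power of `R`.
      obtain ⟨δ, hδ, hlin⟩ : ∃ δ ∈ ordGE F (Fin 2) k,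
          (1 - k : F) • (linForm a b * δ) = -(linForm a b * δ₀) :=
        ⟨-((1 - k : F)⁻¹ • δ₀), neg_mem (Submodule.smul_mem _ _ hδ₀), by
          rw [mul_neg, mul_smul_comm, smul_neg, smul_smul, mul_inv_cancel₀ hk1, one_smul]⟩
      refine ⟨δ, hδ, add_mem h1 (ordGE_anti hk hδ), fun l m hlm hlk => ?_⟩
      have hex := expMap_add_sub (hr g h1) (by omega) (ad_raises hδ) hf1
      have had := ad_sub_mem_ordGE hδ hf
      rw [← map_add ad g δ] at hex
      have hsum := add_mem (ordGE_anti (by omega) hex : _ ∈ ordGE F (Fin 2) (k + 2)) had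
      have h0 := mem_ordGE_iff_expo.mp hsum (l + 1) m (by omega)
      rw [hlin] at h0
      simp only [map_sub (coeff (expo (l + 1) m)), map_add (coeff (expo (l + 1) m)),
        map_neg (coeff (expo (l + 1) m)), hdiv] at h0
      rw [coeff_homogeneousComponent, degree_expo] at h0
      split_ifs at h0 with hdeg
      · linear_combination h0
      · rw [h2 l m hlm (by omega)] at h0
        linear_combination h0)
  refine ⟨g, (hg M le_rfl).1, ?_, fun l m hlm => (hg (l + 1 + m) (by omega)).2 l m hlm le_rfl⟩
  have h1 := (hg M le_rfl).1
  -- Comparison with the zero exponent: `g` has order `M` and `f` has order one, so nothing changes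
  -- up to degree `M`.
  have := expMap_add_sub_mem (P := 0) (Q := ad g) (fun _ _ _ => zero_mem _) (by omega : 1 ≤ M)
    (ad_raises h1) hf1
  rw [zero_add, expMap_of_map_eq_zero (P := 0) rfl] at this
  rwa [add_comm]

end NormalForm

/-! ### The leading part, its symmetry, and the simplest normal form -/

section Simplest

variable {F : Type*} [Field F]

/-- The conditions on the terms `b_r R^r + ∑_{k ≥ r + 2} b_k R^k` of the simplest normal form. -/
structure IsTail (r : ℕ) (G : MvPowerSeries (Fin 2) F) : Prop where
  pure : ∀ l m, coeff (expo (l + 1) m) G = 0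
  mem : G ∈ ordGE F (Fin 2) r
  gap : coeff (expo 0 (r + 1)) G = 0
  eq_zero : coeff (expo 0 r) G = 0 → G = 0

/-- The symmetric generator `R (1 + p x + q R)` of the leading part. -/
def leadSym (p q : F) : MvPowerSeries (Fin 2) F := X 1 * (1 + linForm p q)

/-- The leading part `(a x + b R) (1 + p x + q R)`. -/
def lead (a b p q : F) : MvPowerSeries (Fin 2) F := linForm a b * (1 + linForm p q)

theorem lead_sub_mem (a b p q : F) : lead a b p q - linForm a b ∈ ordGE F (Fin 2) 2 := by
  have : lead a b p q - linForm a b = linForm a b * linForm p q := by rw [lead]; ring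
  rw [this]
  exact mul_mem_ordGE (linForm_mem_ordGE a b) (linForm_mem_ordGE p q)

theorem leadSym_sub_mem (p q : F) : leadSym p q - X 1 ∈ ordGE F (Fin 2) 2 := by
  have : leadSym p q - X 1 = X 1 * linForm p q := by rw [leadSym]; ring
  rw [this]
  exact mul_mem_ordGE (X_mem_ordGE 1) (linForm_mem_ordGE p q)

theorem leadSym_mem (p q : F) : leadSym p q ∈ ordGE F (Fin 2) 1 := by
  have := add_mem (ordGE_anti one_le_two (leadSym_sub_mem p q)) (X_mem_ordGE 1)
  simpa using this

/-- For a common factor `h`, `{u h, v h} = h² {u, v}`, and `{u, v} = 0` when `u` and `v` are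
homogeneous of the same degree. -/
theorem ad_leadSym_lead (a b p q : F) : ad (leadSym p q) (lead a b p q) = 0 := by
  rw [ad_apply, leadSym, lead]
  simp only [Derivation.leibniz, smul_eq_mul, map_add, eul_linForm, eul_X_one,
    Derivation.map_one_eq_zero]
  ring

theorem ad_X_one_apply (G : MvPowerSeries (Fin 2) F) :
    ad (X 1) G = X 1 * (eul F G - G) := by
  rw [ad_apply, eul_X_one]
  ring

/-- The terms of `leadSym` beyond `R` have order two and contribute only from degree `r + 2` on. -/
theorem coeff_ad_leadSym {r : ℕ} {G : MvPowerSeries (Fin 2) F} (hG : G ∈ ordGE F (Fin 2) r)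
    (p q : F) (d : Fin 2 →₀ ℕ) (hd : d.degree < r + 2) :
    coeff d (ad (leadSym p q) G) = coeff d (X 1 * (eul F G - G)) := by
  have h := ad_mem_ordGE (leadSym_sub_mem p q) hG
  rw [map_sub, LinearMap.sub_apply, ad_X_one_apply] at h
  have := h d (by omega)
  rwa [map_sub, sub_eq_zero] at this

theorem coeff_ad_leadSym_pow {r : ℕ} {G : MvPowerSeries (Fin 2) F}
    (hG : G ∈ ordGE F (Fin 2) r) (p q : F) :
    coeff (expo 0 (r + 1)) (ad (leadSym p q) G) = (r - 1 : F) * coeff (expo 0 r) G := by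
  rw [coeff_ad_leadSym hG p q _ (by rw [degree_expo]; omega), coeff_X_one_mul_succ, map_sub,
    coeff_eul, degree_expo, zero_add]
  ring

theorem coeff_ad_leadSym_succ {r : ℕ} {G : MvPowerSeries (Fin 2) F}
    (hG : G ∈ ordGE F (Fin 2) r) (hp : ∀ l m, coeff (expo (l + 1) m) G = 0) (p q : F) (l m : ℕ)
    (hlm : l + 1 + m < r + 2) : coeff (expo (l + 1) m) (ad (leadSym p q) G) = 0 := by
  rw [coeff_ad_leadSym hG p q _ (by rwa [degree_expo])]
  cases m with
  | zero => rw [coeff_X_one_mul_zero]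
  | succ m => rw [coeff_X_one_mul_succ, map_sub, coeff_eul, hp, mul_zero, sub_zero]

variable {a b p q : F} {r : ℕ} {G : MvPowerSeries (Fin 2) F}

theorem lead_add_sub_mem (hr : 2 ≤ r) (hG : G ∈ ordGE F (Fin 2) r) :
    lead a b p q + G - linForm a b ∈ ordGE F (Fin 2) 2 := by
  rw [add_sub_right_comm]
  exact add_mem (lead_sub_mem a b p q) (ordGE_anti hr hG)

/-- Every generator is the sum of a multiple of the vector field, a multiple of `R (1 + p x + q R)`
and a generator without linear part. -/
theorem exists_decomp (ha : a ≠ 0) (hr : 2 ≤ r) (hG : G ∈ ordGE F (Fin 2) r)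
    {Y : MvPowerSeries (Fin 2) F} (hY : Y ∈ ordGE F (Fin 2) 1) :
    ∃ c t : F, ∃ Y' ∈ ordGE F (Fin 2) 2,
      Y = c • (lead a b p q + G) + t • leadSym p q + Y' := by
  -- As `a ≠ 0`, the forms `a x + b R` and `R` span all linear forms: `c` matches the coefficient of
  -- `x`, then `t` that of `R`.
  let c := a⁻¹ * coeff (expo 1 0) Y
  let t := coeff (expo 0 1) Y - c * b
  have hlin : Y - (c • linForm a b + t • X 1) ∈ ordGE F (Fin 2) 2 := by
    rw [mem_ordGE_iff_expo]
    intro l m hlm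
    have h10 : coeff (expo 1 0) (X 0 : MvPowerSeries (Fin 2) F) = 1 := by
      rw [← mul_one (X 0), coeff_X_zero_mul_succ]
      simp [expo]
    have h01 : coeff (expo 0 1) (X 1 : MvPowerSeries (Fin 2) F) = 1 := by
      rw [← mul_one (X 1), coeff_X_one_mul_succ]
      simp [expo]
    have h10' : coeff (expo 1 0) (X 1 : MvPowerSeries (Fin 2) F) = 0 := by
      rw [← mul_one (X 1), coeff_X_one_mul_zero]
    have h01' : coeff (expo 0 1) (X 0 : MvPowerSeries (Fin 2) F) = 0 :=
      X_dvd_iff.mp (dvd_refl _) _ (expo_zero _ _)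
    have hcases : (l = 0 ∧ m = 0) ∨ (l = 1 ∧ m = 0) ∨ (l = 0 ∧ m = 1) := by omega
    rcases hcases with ⟨rfl, rfl⟩ | ⟨rfl, rfl⟩ | ⟨rfl, rfl⟩
    · refine mem_ordGE_iff_expo.mp (sub_mem hY (add_mem (Submodule.smul_mem _ _
        (linForm_mem_ordGE a b)) (Submodule.smul_mem _ _ (X_mem_ordGE 1)))) 0 0 (by omega)
    · simp only [linForm, map_sub, map_add, map_smul, smul_eq_mul, h10, h10', c]
      field_simp
      ring
    · simp only [linForm, map_sub, map_add, map_smul, smul_eq_mul, h01, h01', t]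
      ring
  refine ⟨c, t, Y - (c • (lead a b p q + G) + t • leadSym p q), ?_, by ring⟩
  have e : Y - (c • (lead a b p q + G) + t • leadSym p q)
      = (Y - (c • linForm a b + t • X 1)) - c • (lead a b p q + G - linForm a b)
        - t • (leadSym p q - X 1) := by
    simp only [smul_sub, smul_add]
    ring
  rw [e]
  exact sub_mem (sub_mem hlin (Submodule.smul_mem _ _ (lead_add_sub_mem hr hG)))
    (Submodule.smul_mem _ _ (leadSym_sub_mem p q))

/-- The multiple of the field commutes with the field, and `leadSym` commutes with its leading part,
so it feels only the tail. -/
theorem ad_decomp (c t : F) (Y' : MvPowerSeries (Fin 2) F) :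
    ad (c • (lead a b p q + G) + t • leadSym p q + Y') (lead a b p q + G)
      = t • ad (leadSym p q) G + ad Y' (lead a b p q + G) := by
  rw [map_add ad, LinearMap.add_apply, map_add ad, LinearMap.add_apply, map_smul, map_smul,
    LinearMap.smul_apply, LinearMap.smul_apply, ad_self, smul_zero, zero_add,
    map_add (ad (leadSym p q)), ad_leadSym_lead, zero_add]

theorem coeff_linForm (a b : F) (l m : ℕ) : coeff (expo l m) (linForm a b)
    = (if l = 1 ∧ m = 0 then a else 0) + (if l = 0 ∧ m = 1 then b else 0) := by
  classical
  have h0 : (X 0 : MvPowerSeries (Fin 2) F) = monomial (expo 1 0) 1 := by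
    rw [monomial_expo]; simp
  have h1 : (X 1 : MvPowerSeries (Fin 2) F) = monomial (expo 0 1) 1 := by
    rw [monomial_expo]; simp
  rw [linForm, map_add, map_smul, map_smul, h0, h1, coeff_monomial, coeff_monomial]
  simp [expo_inj]

theorem lead_eq (a b p q : F) : lead a b p q = monomial (expo 1 0) a + monomial (expo 0 1) b
    + monomial (expo 2 0) (a * p) + monomial (expo 1 1) (a * q + b * p)
    + monomial (expo 0 2) (b * q) := by
  have hm : ∀ (l m : ℕ) (c : F), monomial (expo l m) c
      = C c * ((X 0 : MvPowerSeries (Fin 2) F) ^ l * X 1 ^ m) := fun l m c => by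
    rw [← monomial_expo, ← smul_eq_C_mul, ← map_smul, smul_eq_mul, mul_one]
  simp only [hm, lead, linForm, smul_eq_C_mul, map_mul, map_add]
  ring

theorem coeff_lead (a b p q : F) (l m : ℕ) : coeff (expo l m) (lead a b p q)
    = (if l = 1 ∧ m = 0 then a else 0) + (if l = 0 ∧ m = 1 then b else 0)
    + (if l = 2 ∧ m = 0 then a * p else 0) + (if l = 1 ∧ m = 1 then a * q + b * p else 0)
    + (if l = 0 ∧ m = 2 then b * q else 0) := by
  classical
  rw [lead_eq]
  simp only [map_add (coeff (expo l m)), coeff_monomial, expo_inj]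

variable [CharZero F]

/-- Generators without linear part are determined by the terms divisible by `x`. -/
theorem mem_ordGE_of_ad {f Y : MvPowerSeries (Fin 2) F} (ha : a ≠ 0)
    (hf : f - linForm a b ∈ ordGE F (Fin 2) 2) (hY : Y ∈ ordGE F (Fin 2) 2) {M : ℕ}
    (h : ∀ l m, l + 1 + m ≤ M → coeff (expo (l + 1) m) (ad Y f) = 0) :
    Y ∈ ordGE F (Fin 2) M := by
  have key : ∀ j, 2 + j ≤ M → Y ∈ ordGE F (Fin 2) (2 + j) := by
    intro j
    induction j with
    | zero => exact fun _ => hY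
    | succ j ih =>
      intro hj
      refine mem_ordGE_of_linForm_mul ha b (ih (by omega)) fun l m (hlm : l + m = 2 + j) => ?_
      have h0 := mem_ordGE_iff_expo.mp (ad_sub_mem_ordGE (ih (by omega)) hf) (l + 1) m (by omega)
      rw [map_sub, h l m (by omega), zero_sub, neg_eq_zero, map_smul, smul_eq_mul] at h0
      refine (mul_eq_zero.mp h0).resolve_left ?_
      refine sub_ne_zero.mpr ?_
      exact_mod_cast (by omega : 1 ≠ 2 + j)
  rcases le_total M 2 with hM | hM
  · exact ordGE_anti hM hY
  · obtain ⟨j, rfl⟩ := Nat.exists_eq_add_of_le hM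
    exact key j le_rfl

/-- Up to degree `r + 1`, the bracket of `leadSym` with the tail has no terms divisible by `x`. If
none occur in the total up to degree `M`, none occur in the bracket with `Y'` either, and these
determine `Y'`. So the remainder cannot interfere with the power `R^M`. -/
theorem ad_remainder_mem (ha : a ≠ 0) (hr : 2 ≤ r) (hG : IsTail r G) {t : F}
    {Y' : MvPowerSeries (Fin 2) F} (hY' : Y' ∈ ordGE F (Fin 2) 2) {M : ℕ}
    (ht : M ≤ r + 1 ∨ t • ad (leadSym p q) G = 0)
    (h : ∀ l m, l + 1 + m ≤ M →
      coeff (expo (l + 1) m) (t • ad (leadSym p q) G + ad Y' (lead a b p q + G)) = 0) :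
    Y' ∈ ordGE F (Fin 2) M ∧ ad Y' (lead a b p q + G) ∈ ordGE F (Fin 2) (M + 1) := by
  have hf := lead_add_sub_mem (a := a) (b := b) (p := p) (q := q) hr hG.mem
  have hM : Y' ∈ ordGE F (Fin 2) M := by
    refine mem_ordGE_of_ad ha hf hY' fun l m hlm => ?_
    have h0 := h l m hlm
    rcases ht with ht | ht
    · rwa [map_add, map_smul, coeff_ad_leadSym_succ hG.mem hG.pure p q l m (by omega), smul_zero,
        zero_add] at h0
    · rwa [ht, zero_add] at h0
  exact ⟨hM, ad_mem_ordGE hM (mem_ordGE_one_of_sub_linForm hf)⟩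

/-- The only power of `R` of degree at least two that is the leading part of a bracket with the
simplest normal form is `R^(r+1)`. -/
theorem eq_of_coeff_ad_ne_zero (ha : a ≠ 0) (hr : 2 ≤ r) (hG : IsTail r G)
    {Y : MvPowerSeries (Fin 2) F} (hY : Y ∈ ordGE F (Fin 2) 1) {m : ℕ}
    (h : ∀ d : Fin 2 →₀ ℕ, d.degree ≤ m → d ≠ expo 0 m → coeff d (ad Y (lead a b p q + G)) = 0)
    (hne : coeff (expo 0 m) (ad Y (lead a b p q + G)) ≠ 0) :
    m = r + 1 ∧ coeff (expo 0 r) G ≠ 0 := by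
  obtain ⟨c, t, Y', hY', rfl⟩ := exists_decomp (b := b) (p := p) (q := q) ha hr hG.mem hY
  rw [ad_decomp] at h hne
  have hx : ∀ l k, l + 1 + k ≤ m → coeff (expo (l + 1) k)
      (t • ad (leadSym p q) G + ad Y' (lead a b p q + G)) = 0 := fun l k hlk =>
    h _ (by rwa [degree_expo]) (by rw [Ne, expo_inj]; omega)
  have hW : ad (leadSym p q) G ∈ ordGE F (Fin 2) (r + 1) := by
    rw [add_comm]; exact ad_mem_ordGE (leadSym_mem p q) hG.mem
  rcases le_or_gt m (r + 1) with hm | hm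
  · have h1 := (ad_remainder_mem ha hr hG hY' (Or.inl hm) hx).2
    rw [map_add, mem_ordGE_iff_expo.mp h1 0 m (by omega), add_zero, map_smul, smul_eq_mul] at hne
    rcases Nat.lt_or_eq_of_le hm with hm' | rfl
    · rw [mem_ordGE_iff_expo.mp hW 0 m (by omega), mul_zero] at hne
      exact absurd rfl hne
    · rw [coeff_ad_leadSym_pow hG.mem] at hne
      exact ⟨rfl, right_ne_zero_of_mul (right_ne_zero_of_mul hne)⟩
  · have h1 := (ad_remainder_mem ha hr hG hY' (Or.inl le_rfl)
      (fun l k hlk => hx l k (by omega))).2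
    have h2 := h (expo 0 (r + 1)) (by rw [degree_expo]; omega) (by rw [Ne, expo_inj]; omega)
    rw [map_add, mem_ordGE_iff_expo.mp h1 0 (r + 1) (by omega), add_zero, map_smul, smul_eq_mul,
      -- For `m > r + 1` the coefficient at `R^(r+1)` must vanish, so either `t = 0` or the tail is
      -- zero. In both cases the `leadSym` contribution disappears and the remainder alone cannot
      -- produce `R^m`.
      coeff_ad_leadSym_pow hG.mem] at h2
    have hr1 : (r - 1 : F) ≠ 0 := by
      rw [sub_ne_zero]; exact_mod_cast (by omega : r ≠ 1)
    have ht : t • ad (leadSym p q) G = 0 := by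
      rcases mul_eq_zero.mp h2 with h3 | h3
      · rw [h3, zero_smul]
      · rw [hG.eq_zero ((mul_eq_zero.mp h3).resolve_left hr1), map_zero, smul_zero]
    have h3 := (ad_remainder_mem ha hr hG hY' (Or.inr ht) hx).2
    rw [ht, zero_add, mem_ordGE_iff_expo.mp h3 0 m (by omega)] at hne
    exact absurd rfl hne

/-- Only the multiples of the simplest normal form commute with it. -/
theorem eq_smul_of_ad_eq_zero (ha : a ≠ 0) (hr : 2 ≤ r) (hG : IsTail r G)
    (hB : coeff (expo 0 r) G ≠ 0) {Y : MvPowerSeries (Fin 2) F} (hY : Y ∈ ordGE F (Fin 2) 1)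
    (h : ad Y (lead a b p q + G) = 0) : ∃ c : F, Y = c • (lead a b p q + G) := by
  obtain ⟨c, t, Y', hY', rfl⟩ := exists_decomp (b := b) (p := p) (q := q) ha hr hG.mem hY
  rw [ad_decomp] at h
  have hx : ∀ M l k, l + 1 + k ≤ M → coeff (expo (l + 1) k)
      (t • ad (leadSym p q) G + ad Y' (lead a b p q + G)) = 0 := fun M l k _ => by
    rw [h, map_zero]
  have h1 := (ad_remainder_mem ha hr hG hY' (Or.inl le_rfl) (hx (r + 1))).2
  have h2 : coeff (expo 0 (r + 1)) (t • ad (leadSym p q) G + ad Y' (lead a b p q + G)) = 0 := by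
    rw [h, map_zero]
  have hr1 : (r - 1 : F) ≠ 0 := by
    rw [sub_ne_zero]; exact_mod_cast (by omega : r ≠ 1)
  rw [map_add, mem_ordGE_iff_expo.mp h1 0 (r + 1) (by omega), add_zero, map_smul, smul_eq_mul,
    coeff_ad_leadSym_pow hG.mem] at h2
  have ht : t = 0 := (mul_eq_zero.mp h2).resolve_right (mul_ne_zero hr1 hB)
  have hY0 : Y' = 0 := eq_zero_of_forall_mem_ordGE fun M =>
    (ad_remainder_mem ha hr hG hY' (Or.inr (by rw [ht, zero_smul])) (hx M)).1
  exact ⟨c, by rw [hY0, ht, zero_smul, add_zero, add_zero]⟩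

/-- Every vector field can be sent into the simplest normal form. -/
theorem exists_flowEquiv_simplest {f : MvPowerSeries (Fin 2) F} (ha : a ≠ 0)
    (h0 : coeff (expo 0 0) f = 0) (h10 : coeff (expo 1 0) f = a) (h01 : coeff (expo 0 1) f = b)
    (h20 : coeff (expo 2 0) f = a * p) (h11 : coeff (expo 1 1) f = a * q + b * p) :
    ∃ r G, 2 ≤ r ∧ IsTail r G ∧ FlowEquiv f (lead a b p q + G) ∧
      (coeff (expo 0 2) f ≠ b * q → r = 2) ∧ (coeff (expo 0 2) f = b * q → 2 < r) ∧
      coeff (expo 0 2) G = coeff (expo 0 2) f - b * q := by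
  have hf : f - linForm a b ∈ ordGE F (Fin 2) 2 := by
    rw [mem_ordGE_iff_expo]
    intro l m hlm
    have hcases : (l = 0 ∧ m = 0) ∨ (l = 1 ∧ m = 0) ∨ (l = 0 ∧ m = 1) := by omega
    rcases hcases with ⟨rfl, rfl⟩ | ⟨rfl, rfl⟩ | ⟨rfl, rfl⟩ <;>
      simp [coeff_linForm, h0, h10, h01]
  -- Normalizing above degree two keeps the quadratic part, which agrees with `lead` except possibly
  -- at `R²`. The difference `G₁` is thus a series in `R` alone.
  obtain ⟨g₁, hg₁, he₁, hp₁⟩ := exists_ad_normalize ha le_rfl hf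
  have hE₁ := flowEquiv_expMap (ordGE_anti one_le_two hg₁) f
  obtain ⟨G₁, hG₁⟩ : ∃ G₁, expMap (ad g₁) f = lead a b p q + G₁ := ⟨_, (add_sub_cancel _ _).symm⟩
  rw [hG₁] at he₁ hp₁ hE₁
  have hlow : ∀ l m, l + m ≤ 2 → coeff (expo l m) G₁
      = coeff (expo l m) f - coeff (expo l m) (lead a b p q) := fun l m hlm => by
    have := mem_ordGE_iff_expo.mp he₁ l m (by omega)
    rw [map_sub, map_add] at this
    linear_combination this
  have hpure₁ : ∀ l m, coeff (expo (l + 1) m) G₁ = 0 := by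
    intro l m
    rcases le_or_gt (l + 1 + m) 2 with hlm | hlm
    · rw [hlow _ _ hlm]
      have hcases : (l = 0 ∧ m = 0) ∨ (l = 1 ∧ m = 0) ∨ (l = 0 ∧ m = 1) := by omega
      rcases hcases with ⟨rfl, rfl⟩ | ⟨rfl, rfl⟩ | ⟨rfl, rfl⟩ <;>
        simp [coeff_lead, h10, h20, h11]
    · have := hp₁ l m hlm
      rw [map_add, coeff_lead, if_neg (by omega), if_neg (by omega), if_neg (by omega),
        if_neg (by omega), if_neg (by omega)] at this
      simpa using this
  have hG₁2 : coeff (expo 0 2) G₁ = coeff (expo 0 2) f - b * q := by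
    rw [hlow 0 2 (by omega)]
    simp [coeff_lead]
  by_cases hz : G₁ = 0
  · subst hz
    rw [map_zero] at hG₁2
    -- With a zero tail the index is arbitrary; `3` meets the requirement `2 < r` of the case in
    -- which the `R²` coefficient equals `b q`.
    refine ⟨3, 0, by omega, ⟨fun _ _ => map_zero _, zero_mem _, map_zero _, fun _ => rfl⟩, hE₁,
      fun h => absurd (sub_eq_zero.mp hG₁2.symm) h, fun _ => by omega, ?_⟩
    rw [map_zero, hG₁2]
  have hex : ∃ k, coeff (expo 0 k) G₁ ≠ 0 := by
    by_contra! hcon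
    refine hz (ext_expo fun l m => ?_)
    rw [map_zero]
    cases l with
    | zero => exact hcon m
    | succ l => exact hpure₁ l m
  classical
  obtain ⟨r, hB, hmin⟩ : ∃ r, coeff (expo 0 r) G₁ ≠ 0 ∧ ∀ k < r, coeff (expo 0 k) G₁ = 0 :=
    ⟨Nat.find hex, Nat.find_spec hex, fun k hk => not_not.mp (Nat.find_min hex hk)⟩
  have hr2 : 2 ≤ r := by
    by_contra hlt
    refine hB ?_
    rw [hlow 0 r (by omega)]
    have : r = 0 ∨ r = 1 := by omega
    rcases this with rfl | rfl <;> simp [coeff_lead, h0, h01]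
  have hmem₁ : G₁ ∈ ordGE F (Fin 2) r := by
    rw [mem_ordGE_iff_expo]
    intro l m hlm
    cases l with
    | zero => exact hmin m (by omega)
    | succ l => exact hpure₁ l m
  have hr1 : (r - 1 : F) ≠ 0 := by
    rw [sub_ne_zero]; exact_mod_cast (by omega : r ≠ 1)
  -- The flow of `t • leadSym` fixes `lead` and adds `t (r - 1) b_r` to the coefficient of
  -- `R^(r+1)`; this `t` makes it zero.
  let t : F := -coeff (expo 0 (r + 1)) G₁ / ((r - 1) * coeff (expo 0 r) G₁)
  have hg₂ : t • leadSym p q ∈ ordGE F (Fin 2) 1 := Submodule.smul_mem _ _ (leadSym_mem p q)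
  have hE₂ := flowEquiv_expMap hg₂ (lead a b p q + G₁)
  rw [expMap_add, expMap_of_map_eq_zero (h := lead a b p q)
    (by rw [map_smul, LinearMap.smul_apply, ad_leadSym_lead, smul_zero])] at hE₂
  have hexp := expMap_sub_two (ad_raises hg₂) hmem₁
  generalize expMap (ad (t • leadSym p q)) G₁ = G₂ at hE₂ hexp
  have hc₂ : ∀ l m, l + m < r + 2 → coeff (expo l m) G₂
      = coeff (expo l m) G₁ + t * coeff (expo l m) (ad (leadSym p q) G₁) := fun l m hlm => by
    have := mem_ordGE_iff_expo.mp hexp l m hlm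
    rw [map_smul, LinearMap.smul_apply, map_sub, map_add, map_smul, smul_eq_mul] at this
    exact sub_eq_zero.mp this
  have hW : ad (leadSym p q) G₁ ∈ ordGE F (Fin 2) (r + 1) := by
    rw [add_comm]; exact ad_mem_ordGE (leadSym_mem p q) hmem₁
  have hle₂ : ∀ l m, l + m ≤ r → coeff (expo l m) G₂ = coeff (expo l m) G₁ := fun l m hlm => by
    rw [hc₂ l m (by omega), mem_ordGE_iff_expo.mp hW l m (by omega), mul_zero, add_zero]
  have hgap₂ : coeff (expo 0 (r + 1)) G₂ = 0 := by
    rw [hc₂ _ _ (by omega), coeff_ad_leadSym_pow hmem₁, div_mul_cancel₀ _ (mul_ne_zero hr1 hB),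
      add_neg_cancel]
  have hpure₂ : ∀ l m, l + 1 + m < r + 2 → coeff (expo (l + 1) m) G₂ = 0 := fun l m hlm => by
    rw [hc₂ _ _ hlm, hpure₁, coeff_ad_leadSym_succ hmem₁ hpure₁ p q l m hlm, mul_zero, add_zero]
  have hmem₂ : G₂ ∈ ordGE F (Fin 2) r := by
    rw [mem_ordGE_iff_expo]
    intro l m hlm
    rw [hle₂ l m (by omega)]
    exact mem_ordGE_iff_expo.mp hmem₁ l m hlm
  -- The flow of `leadSym` may bring back multiples of `x`, but only from degree `r + 2` on.
  -- Normalizing above `r + 1` removes them and keeps the gap at `R^(r+1)`.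
  obtain ⟨g₃, hg₃, he₃, hp₃⟩ := exists_ad_normalize ha (by omega : 2 ≤ r + 1)
    (lead_add_sub_mem (a := a) (b := b) (p := p) (q := q) hr2 hmem₂)
  have hE₃ := flowEquiv_expMap (ordGE_anti (by omega) hg₃) (lead a b p q + G₂)
  obtain ⟨G₃, hG₃⟩ : ∃ G₃, expMap (ad g₃) (lead a b p q + G₂) = lead a b p q + G₃ :=
    ⟨_, (add_sub_cancel _ _).symm⟩
  rw [hG₃] at he₃ hp₃ hE₃
  rw [add_sub_add_left_eq_sub] at he₃
  have hlow₃ : ∀ l m, l + m < r + 2 → coeff (expo l m) G₃ = coeff (expo l m) G₂ :=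
    fun l m hlm => by
      have := mem_ordGE_iff_expo.mp he₃ l m hlm
      rwa [map_sub, sub_eq_zero] at this
  have hB₃ : coeff (expo 0 r) G₃ = coeff (expo 0 r) G₁ := by
    rw [hlow₃ _ _ (by omega), hle₂ _ _ (by omega)]
  refine ⟨r, G₃, hr2, ⟨fun l m => ?_, ?_, ?_, fun h => absurd (hB₃.symm.trans h) hB⟩,
    (hE₁.trans hE₂).trans hE₃, fun h => ?_, fun h => ?_, ?_⟩
  · rcases lt_or_ge (l + 1 + m) (r + 2) with hlm | hlm
    · rw [hlow₃ _ _ hlm, hpure₂ l m hlm]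
    · have := hp₃ l m (by omega)
      rw [map_add, coeff_lead, if_neg (by omega), if_neg (by omega), if_neg (by omega),
        if_neg (by omega), if_neg (by omega)] at this
      simpa using this
  · rw [mem_ordGE_iff_expo]
    intro l m hlm
    rw [hlow₃ l m (by omega)]
    exact mem_ordGE_iff_expo.mp hmem₂ l m hlm
  · rw [hlow₃ _ _ (by omega), hgap₂]
  · by_contra hne
    exact h (sub_eq_zero.mp (hG₁2.symm.trans (hmin 2 (by omega))))
  · refine lt_of_le_of_ne hr2 fun h2 => hB ?_
    rw [← h2, hG₁2, h, sub_self]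
  · rw [hlow₃ _ _ (by omega), hle₂ _ _ (by omega), hG₁2]

end Simplest

/-! ### The grading with weights 1 for `x` and 2 for `R` -/

section Grading

variable {F : Type*} [Field F]

/-- The component of grade `n` of a power series in `x` (of grade `1`) and `R` (of grade `2`). -/
abbrev wtPart (n : ℕ) : Module.End F (MvPowerSeries (Fin 2) F) :=
  weightedHomogeneousComponent ![1, 2] n

theorem weight_eq (d : Fin 2 →₀ ℕ) : Finsupp.weight ![1, 2] d = d 0 + 2 * d 1 := by
  rw [Finsupp.weight_apply, Finsupp.sum_fintype _ _ (by simp), Fin.sum_univ_two]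
  simp [mul_comm]

theorem coeff_wtPart (n : ℕ) (d : Fin 2 →₀ ℕ) (f : MvPowerSeries (Fin 2) F) :
    coeff d (wtPart n f) = if d 0 + 2 * d 1 = n then coeff d f else 0 := by
  rw [coeff_weightedHomogeneousComponent, weight_eq]

theorem coeff_wtPart_expo (n l m : ℕ) (f : MvPowerSeries (Fin 2) F) :
    coeff (expo l m) (wtPart n f) = if l + 2 * m = n then coeff (expo l m) f else 0 := by
  rw [coeff_wtPart, expo_zero, expo_one]

theorem wtPart_raises (n : ℕ) :
    Raises (wtPart n : Module.End F (MvPowerSeries (Fin 2) F)) 0 := by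
  intro k h hh d hd
  rw [coeff_wtPart, hh d hd, ite_self]

theorem wtPart_zero_of_mem {f : MvPowerSeries (Fin 2) F} (hf : f ∈ ordGE F (Fin 2) 1) :
    wtPart 0 f = 0 := by
  refine ext_expo fun l m => ?_
  rw [coeff_wtPart_expo, map_zero]
  split_ifs with h
  · exact mem_ordGE_iff_expo.mp hf l m (by omega)
  · rfl

theorem wtPart_mul (n : ℕ) (f g : MvPowerSeries (Fin 2) F) :
    wtPart n (f * g) = ∑ i ∈ Finset.range (n + 1), wtPart (n - i) f * wtPart i g := by
  classical
  ext d
  rw [coeff_wtPart, map_sum]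
  simp only [coeff_mul, coeff_wtPart]
  rw [Finset.sum_comm]
  split_ifs with hd
  · refine Finset.sum_congr rfl fun uv huv => ?_
    have huv' := Finset.HasAntidiagonal.mem_antidiagonal.mp huv
    have h0 := DFunLike.congr_fun huv' 0
    have h1 := DFunLike.congr_fun huv' 1
    rw [Finsupp.add_apply] at h0 h1
    rw [Finset.sum_eq_single (uv.2 0 + 2 * uv.2 1)]
    · rw [if_pos (by omega), if_pos rfl]
    · intro i _ hne
      rw [if_neg (Ne.symm hne), mul_zero]
    · intro hni
      exact absurd (Finset.mem_range.mpr (by omega)) hni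
  · refine (Finset.sum_eq_zero fun uv huv => Finset.sum_eq_zero fun i hi => ?_).symm
    have huv' := Finset.HasAntidiagonal.mem_antidiagonal.mp huv
    have h0 := DFunLike.congr_fun huv' 0
    have h1 := DFunLike.congr_fun huv' 1
    rw [Finsupp.add_apply] at h0 h1
    have hi' := Finset.mem_range.mp hi
    by_cases hu : uv.1 0 + 2 * uv.1 1 = n - i
    · rw [if_neg (by omega : ¬ uv.2 0 + 2 * uv.2 1 = i), mul_zero]
    · rw [if_neg hu, zero_mul]

theorem wtPart_eul (n : ℕ) (f : MvPowerSeries (Fin 2) F) :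
    wtPart n (eul F f) = eul F (wtPart n f) := by
  ext d
  rw [coeff_wtPart, coeff_eul, coeff_eul, coeff_wtPart]
  split_ifs <;> simp

/-- The Euler derivation preserves grades, so the bracket is additive in the grade, like the
product. -/
theorem wtPart_ad (n : ℕ) (g f : MvPowerSeries (Fin 2) F) :
    wtPart n (ad g f) = ∑ i ∈ Finset.range (n + 1), ad (wtPart (n - i) g) (wtPart i f) := by
  rw [ad_apply, map_sub, mul_comm f, wtPart_mul, wtPart_mul, ← Finset.sum_sub_distrib]
  refine Finset.sum_congr rfl fun i _ => ?_
  rw [ad_apply, wtPart_eul, wtPart_eul]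
  ring

theorem wtPart_wtPart (m n : ℕ) (f : MvPowerSeries (Fin 2) F) :
    wtPart m (wtPart n f) = if m = n then wtPart n f else 0 := by
  ext d
  rw [coeff_wtPart, coeff_wtPart]
  by_cases hmn : m = n
  · rw [if_pos hmn, coeff_wtPart, hmn]
    split_ifs <;> rfl
  · rw [if_neg hmn, coeff_zero]
    split_ifs with h1 h2
    · omega
    · rfl
    · rfl

theorem isHomogeneous_X (i : Fin 3) : IsHomogeneous (X i : MvPowerSeries (Fin 3) F) 1 := by
  classical
  intro d hd
  rw [coeff_X] at hd
  change Finsupp.weight (fun _ => 1) d = 1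
  rw [← Finsupp.degree_eq_weight_one]
  have : d = Finsupp.single i 1 := by
    by_contra h
    exact hd (if_neg h)
  rw [this, Finsupp.degree_single]

theorem isHomogeneous_pow {h : MvPowerSeries (Fin 3) F} {k : ℕ} (hh : IsHomogeneous h k)
    (n : ℕ) : IsHomogeneous (h ^ n) (n * k) := by
  induction n with
  | zero =>
    classical
    intro d hd
    rw [pow_zero, coeff_one] at hd
    have : d = 0 := by
      by_contra h
      exact hd (if_neg h)
    rw [this, map_zero, zero_mul]
  | succ n ih => rw [pow_succ, add_mul, one_mul]; exact ih.mul hh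

theorem isHomogeneous_smul {h : MvPowerSeries (Fin 3) F} {k : ℕ} (hh : IsHomogeneous h k)
    (c : F) : IsHomogeneous (c • h) k := fun {d} hd => hh (d := d) fun h0 => hd (by
      rw [map_smul, h0, smul_zero])

theorem isHomogeneous_rho : IsHomogeneous (rho : MvPowerSeries (Fin 3) F) 2 :=
  IsHomogeneous.add (isHomogeneous_pow (isHomogeneous_X 1) 2)
    (isHomogeneous_pow (isHomogeneous_X 2) 2)

theorem isHomogeneous_Euler (i : Fin 3) :
    IsHomogeneous (Euler i : MvPowerSeries (Fin 3) F) 1 := by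
  fin_cases i
  · exact isHomogeneous_X 0
  · exact isHomogeneous_smul (isHomogeneous_X 1) _
  · exact isHomogeneous_smul (isHomogeneous_X 2) _

theorem isHomogeneous_Theta (i : Fin 3) :
    IsHomogeneous (Theta i : MvPowerSeries (Fin 3) F) 1 := by
  fin_cases i
  · exact fun {d} hd => absurd (map_zero _) hd
  · exact isHomogeneous_X 2
  · change IsHomogeneous (-X 1 : MvPowerSeries (Fin 3) F) 1
    rw [← neg_one_smul F]
    exact isHomogeneous_smul (isHomogeneous_X 1) _

theorem gradePart_apply (n : ℕ) (v : VF F) (i : Fin 3) :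
    gradePart n v i = homogeneousComponent (n + 1) (v i) := by
  ext d
  rw [coeff_homogeneousComponent]
  rfl

theorem homogeneousComponent_of_isHomogeneous {h : MvPowerSeries (Fin 3) F} {k : ℕ}
    (hh : IsHomogeneous h k) (n : ℕ) :
    homogeneousComponent n h = if n = k then h else 0 := by
  ext d
  rw [coeff_homogeneousComponent]
  split_ifs with h1 h2 h2
  · rfl
  · exact hh.coeff_eq_zero (by omega)
  · exact (hh.coeff_eq_zero (by omega)).symm
  · rfl

/-- Checked on monomials: the components of `x^l R^m E` are homogeneous of degree `l + 2m + 1`. -/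
theorem gradePart_psi (n : ℕ) (f : MvPowerSeries (Fin 2) F) :
    gradePart n (psi f) = psi (wtPart n f) := by
  funext i
  rw [gradePart_apply, psi_apply, psi_apply]
  let T : MvPowerSeries (Fin 2) F →ₗ[F] MvPowerSeries (Fin 3) F :=
    LinearMap.mulRight F (Euler i) ∘ₗ (emb F).toLinearMap
  have hT : Raises T 0 := fun k h hh => by
    have := mul_mem_ordGE (emb_mem_ordGE hh) (Euler_mem_ordGE (F := F) i)
    exact ordGE_anti (by omega) this
  have hH : Raises (homogeneousComponent (n + 1) :
      Module.End F (MvPowerSeries (Fin 3) F)) 0 := fun k h hh d hd => by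
    rw [coeff_homogeneousComponent, hh d hd, ite_self]
  refine LinearMap.congr_fun (raises_ext (T := homogeneousComponent (n + 1) ∘ₗ T)
    (U := T ∘ₗ wtPart n) (Raises.comp hH hT) (Raises.comp hT (wtPart_raises n)) fun d => ?_) f
  have h1 : T (monomial d 1) = X 0 ^ d 0 * rho ^ d 1 * Euler i := by
    rw [← emb_monomial]; rfl
  have h2 : IsHomogeneous (T (monomial d 1)) (d 0 + 2 * d 1 + 1) := by
    rw [h1]
    have h4 : IsHomogeneous (X 0 ^ d 0 * rho ^ d 1 * Euler i : MvPowerSeries (Fin 3) F)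
        (d 0 * 1 + d 1 * 2 + 1) :=
      IsHomogeneous.mul (IsHomogeneous.mul (isHomogeneous_pow (isHomogeneous_X 0) (d 0))
        (isHomogeneous_pow isHomogeneous_rho (d 1))) (isHomogeneous_Euler i)
    rwa [mul_one, mul_comm (d 1) 2] at h4
  have h3 : wtPart n (monomial d (1 : F)) = if n = d 0 + 2 * d 1 then monomial d 1 else 0 := by
    classical
    ext e
    rw [coeff_wtPart]
    split_ifs with h4 h5 h5
    · rfl
    · rw [coeff_monomial, if_neg (by rintro rfl; exact h5 h4.symm), map_zero]
    · rw [coeff_monomial, if_neg (by rintro rfl; exact h4 h5.symm)]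
    · rw [map_zero]
  change homogeneousComponent (n + 1) (T (monomial d 1)) = T (wtPart n (monomial d 1))
  rw [homogeneousComponent_of_isHomogeneous h2, h3]
  split_ifs with h4 h5 h5
  · rfl
  · omega
  · omega
  · rw [map_zero]

theorem gradePart_Theta_add_psi (n : ℕ) (f : MvPowerSeries (Fin 2) F) :
    gradePart n (Theta + psi f) = (if n = 0 then Theta else 0) + psi (wtPart n f) := by
  rw [← gradePart_psi]
  funext i
  rw [gradePart_apply, Pi.add_apply, Pi.add_apply, map_add, gradePart_apply,
    homogeneousComponent_of_isHomogeneous (isHomogeneous_Theta i)]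
  congr 1
  split_ifs with h1 h2 h2
  · rfl
  · omega
  · omega
  · rfl

/-- The monomials of grade `n` with exponents in `J`. -/
def monoSet (n : ℕ) (J : Set (Fin 2 →₀ ℕ)) : Set (VF F) :=
  {v | ∃ d : Fin 2 →₀ ℕ, d ≠ 0 ∧ d 0 + 2 * d 1 = n ∧ d ∈ J ∧ v = psi (monomial d 1)}

theorem monoSet_univ (n : ℕ) : monoSet (F := F) n Set.univ =
    {v | ∃ l k : ℕ, l ≤ k ∧ 1 ≤ l + k ∧ 2 * k = n + l ∧ v = qE F l k} := by
  ext v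
  constructor
  · rintro ⟨d, hd, hn, -, rfl⟩
    refine ⟨d 0, d 0 + d 1, by omega, ?_, by omega, ?_⟩
    · by_contra h
      refine hd ((Finsupp.degree_eq_zero_iff d).mp ?_)
      rw [degree_fin_two]
      omega
    · rw [qE_eq_psi, Nat.add_sub_cancel_left, expo_eta]
  · rintro ⟨l, k, hlk, h1, h2, rfl⟩
    refine ⟨expo l (k - l), ?_, ?_, trivial, qE_eq_psi l k⟩
    · intro h
      have h0 := DFunLike.congr_fun h 0
      have h1 := DFunLike.congr_fun h 1
      rw [expo_zero, Finsupp.zero_apply] at h0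
      rw [expo_one, Finsupp.zero_apply] at h1
      omega
    · rw [expo_zero, expo_one]
      omega

theorem monoSet_mono (n : ℕ) (J : Set (Fin 2 →₀ ℕ)) :
    monoSet (F := F) n J ⊆ monoSet n Set.univ := by
  rintro v ⟨d, hd, hn, -, rfl⟩
  exact ⟨d, hd, hn, trivial, rfl⟩

theorem gradeSpace_eq (n : ℕ) : gradeSpace F n = Submodule.span F (monoSet n Set.univ) := by
  rw [monoSet_univ, gradeSpace]

theorem mem_span_monoSet {n : ℕ} {J : Set (Fin 2 →₀ ℕ)} {v : VF F} :
    v ∈ Submodule.span F (monoSet n J) ↔ ∃ p ∈ ordGE F (Fin 2) 1, wtPart n p = p ∧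
      (∀ d, d ∉ J → coeff d p = 0) ∧ v = psi p := by
  classical
  constructor
  · intro hv
    induction hv using Submodule.span_induction with
    | mem v hv =>
      obtain ⟨d, hd, hn, hJ, rfl⟩ := hv
      refine ⟨monomial d 1, mem_ordGE_one.mpr ?_, ?_, fun e he => ?_, rfl⟩
      · rw [coeff_monomial, if_neg (Ne.symm hd)]
      · ext e
        rw [coeff_wtPart]
        split_ifs with he
        · rfl
        · rw [coeff_monomial, if_neg (by rintro rfl; exact he hn)]
      · rw [coeff_monomial, if_neg (by rintro rfl; exact he hJ)]
    | zero => exact ⟨0, zero_mem _, map_zero _, fun _ _ => map_zero _, (map_zero _).symm⟩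
    | add v w _ _ hv hw =>
      obtain ⟨p, h1, h2, h3, rfl⟩ := hv
      obtain ⟨q, k1, k2, k3, rfl⟩ := hw
      exact ⟨p + q, add_mem h1 k1, by rw [map_add, h2, k2],
        fun d hd => by rw [map_add, h3 d hd, k3 d hd, add_zero], (map_add _ _ _).symm⟩
    | smul c v _ hv =>
      obtain ⟨p, h1, h2, h3, rfl⟩ := hv
      exact ⟨c • p, Submodule.smul_mem _ _ h1, by rw [map_smul, h2],
        fun d hd => by rw [map_smul, h3 d hd, smul_zero], (map_smul _ _ _).symm⟩
  · rintro ⟨p, h1, h2, h3, rfl⟩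
    have hw : ∀ d, coeff d p ≠ 0 → d 0 + 2 * d 1 = n := by
      intro d hd
      by_contra hne
      rw [← h2, coeff_wtPart, if_neg hne] at hd
      exact hd rfl
    -- The degree is at most the weight, so a series of grade `n` is a polynomial of degree at most
    -- `n` and a finite sum of monomials.
    have hp : p = (truncTotal (n + 1) p : MvPolynomial (Fin 2) F) := by
      ext d
      rw [MvPolynomial.coeff_coe]
      by_cases hd : d.degree < n + 1
      · rw [coeff_truncTotal _ hd]
      · rw [coeff_truncTotal_eq_zero _ (by omega)]
        by_contra hne
        have := hw d hne
        rw [degree_fin_two] at hd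
        omega
    have hsum : p = ∑ d ∈ (truncTotal (n + 1) p).support,
        coeff d p • monomial d (1 : F) := by
      conv_lhs => rw [hp, (truncTotal (n + 1) p).as_sum]
      rw [← MvPolynomial.coeToMvPowerSeries.ringHom_apply, map_sum]
      refine Finset.sum_congr rfl fun d _ => ?_
      rw [MvPolynomial.coeToMvPowerSeries.ringHom_apply, MvPolynomial.coe_monomial, ← map_smul,
        smul_eq_mul, mul_one]
      conv_rhs => rw [hp, MvPolynomial.coeff_coe]
    rw [hsum, map_sum]
    refine Submodule.sum_mem _ fun d _ => ?_
    rw [map_smul]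
    by_cases hd : coeff d p = 0
    · rw [hd, zero_smul]
      exact zero_mem _
    · refine Submodule.smul_mem _ _ (Submodule.subset_span ⟨d, ?_, hw d hd, ?_, rfl⟩)
      · rintro rfl
        exact hd (mem_ordGE_one.mp h1)
      · by_contra hJ
        exact hd (h3 d hJ)

theorem psi_wtPart_mem_gradeSpace {n : ℕ} {p : MvPowerSeries (Fin 2) F}
    (hp : p ∈ ordGE F (Fin 2) 1) : psi (wtPart n p) ∈ gradeSpace F n := by
  rw [gradeSpace_eq]
  exact mem_span_monoSet.mpr ⟨wtPart n p, wtPart_raises n 1 p hp,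
    by rw [wtPart_wtPart, if_pos rfl], fun d hd => absurd trivial hd, rfl⟩

end Grading

/-! ### State maps in terms of brackets of power series -/

section StateMaps

variable {F : Type*} [Field F]

/-- The recursion unrolled: all lower state sums vanish. For `s ≥ k` the sum is empty, so no bound
on `s` is needed. -/
theorem inKer_iff (v : VF F) (Y : ℕ → VF F) (n k : ℕ) :
    InKer v n k Y ↔ ∀ s, stateSum v (n - s) (k - s) Y = 0 := by
  induction k generalizing n with
  | zero => simp [InKer, stateSum]
  | succ k ih =>
    rw [InKer, ih]
    constructor
    · rintro ⟨h1, h2⟩ s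
      cases s with
      | zero => exact h2
      | succ s =>
        have := h1 s
        rwa [Nat.sub_sub, add_comm 1 s, ← Nat.add_sub_add_right k 1 s] at this
    · intro h
      refine ⟨fun s => ?_, h 0⟩
      have := h (s + 1)
      rwa [Nat.sub_sub, add_comm 1 s, ← Nat.add_sub_add_right k 1 s]

theorem bracket_psi_gradePart [CharZero F] (y f : MvPowerSeries (Fin 2) F) (i : ℕ) :
    bracket (psi y) (gradePart i (Theta + psi f)) = psi (ad y (wtPart i f)) := by
  rw [gradePart_Theta_add_psi, bracket_add_right, bracket_psi]
  split_ifs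
  · rw [bracket_psi_Theta, zero_add]
  · have : (0 : VF F) = psi 0 := (map_zero _).symm
    rw [this, bracket_psi, map_zero, map_zero, zero_add]

theorem stateSum_psi [CharZero F] (y : ℕ → MvPowerSeries (Fin 2) F)
    (f : MvPowerSeries (Fin 2) F) (n k : ℕ) :
    stateSum (Theta + psi f) n k (fun j => psi (y j))
      = psi (∑ i ∈ Finset.range k, ad (y (n - i)) (wtPart i f)) := by
  rw [stateSum, map_sum]
  exact Finset.sum_congr rfl fun i _ => bracket_psi_gradePart _ _ _

/-- A tuple `(Y_n, ..., Y_(n-k+1))` is encoded as one series `y` without components of grade at most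
`n - k`; the state sum is then a full grade component of one bracket. -/
theorem sum_ad_wtPart_eq {y f : MvPowerSeries (Fin 2) F} {n k : ℕ} (hk : k ≤ n + 1)
    (hy : ∀ j, j + k ≤ n → wtPart j y = 0) :
    ∑ i ∈ Finset.range k, ad (wtPart (n - i) y) (wtPart i f) = wtPart n (ad y f) := by
  rw [wtPart_ad]
  refine Finset.sum_subset (Finset.range_subset_range.mpr hk) fun i hi hik => ?_
  rw [Finset.mem_range] at hi hik
  rw [hy (n - i) (by omega), map_zero, LinearMap.zero_apply]

theorem mem_stateImage_of_wtPart [CharZero F] {f y : MvPowerSeries (Fin 2) F} {n k : ℕ}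
    (hy1 : y ∈ ordGE F (Fin 2) 1) (hy : ∀ j, j + min k n ≤ n → wtPart j y = 0)
    (h : ∀ m < n, wtPart m (ad y f) = 0) :
    psi (wtPart n (ad y f)) ∈ stateImage (Theta + psi f) n k := by
  refine ⟨fun j => psi (wtPart j y), fun j => psi_wtPart_mem_gradeSpace hy1, ?_, ?_⟩
  · rw [inKer_iff]
    intro s
    rw [stateSum_psi]
    by_cases hs : s < min k n - 1
    · rw [sum_ad_wtPart_eq (by omega) (fun j hj => hy j (by omega)), h _ (by omega), map_zero]
    · rw [show min k n - 1 - s = 0 by omega, Finset.range_zero, Finset.sum_empty, map_zero]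
  · rw [stateSum_psi, sum_ad_wtPart_eq (by omega) hy]

theorem exists_of_mem_stateImage [CharZero F] {f : MvPowerSeries (Fin 2) F} {n k : ℕ} {W : VF F}
    (hn : 1 ≤ n) (hk : 1 ≤ k) (hW : W ∈ stateImage (Theta + psi f) n k) :
    ∃ y ∈ ordGE F (Fin 2) 1, (∀ m < n, wtPart m (ad y f) = 0) ∧
      W = psi (wtPart n (ad y f)) := by
  obtain ⟨Y, hY, hker, rfl⟩ := hW
  have hex : ∀ j, ∃ p ∈ ordGE F (Fin 2) 1, wtPart j p = p ∧ Y j = psi p := by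
    intro j
    have := hY j
    rw [gradeSpace_eq] at this
    obtain ⟨p, h1, h2, -, h3⟩ := mem_span_monoSet.mp this
    exact ⟨p, h1, h2, h3⟩
  choose p hp1 hp2 hp3 using hex
  have hYp : Y = fun j => psi (p j) := funext hp3
  subst hYp
  set K := min k n with hK
  have hK1 : 1 ≤ K := le_min hk hn
  have hKn : K ≤ n := min_le_right _ _
  -- Only the entries `Y_(n-K+1), ..., Y_n` occur in the state map; the others are dropped so that
  -- the bracket has nothing in grades up to `n - K`. In the grades between, the kernel conditions
  -- make it vanish.
  let y := ∑ j ∈ Finset.Ioc (n - K) n, p j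
  have hyj : ∀ j, wtPart j y = if j ∈ Finset.Ioc (n - K) n then p j else 0 := by
    intro j
    rw [map_sum]
    have : ∀ i, wtPart j (p i) = if j = i then p i else 0 := fun i => by
      rw [← hp2 i, wtPart_wtPart, hp2]
    simp only [this, Finset.sum_ite_eq]
  have hsum : ∀ s, s < K → stateSum (Theta + psi f) (n - s) (K - s) (fun j => psi (p j))
      = psi (wtPart (n - s) (ad y f)) := by
    intro s hs
    rw [stateSum_psi, ← sum_ad_wtPart_eq (k := K - s) (by omega) (fun j hj => ?_)]
    · congr 1
      refine Finset.sum_congr rfl fun i hi => ?_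
      rw [Finset.mem_range] at hi
      rw [hyj, if_pos (Finset.mem_Ioc.mpr (by omega))]
    · rw [hyj, if_neg (by rw [Finset.mem_Ioc]; omega)]
  refine ⟨y, Submodule.sum_mem _ fun j _ => hp1 j, fun m hm => ?_, hsum 0 (by omega)⟩
  by_cases hmK : n < m + K
  · have h1 := (inKer_iff _ _ _ _).mp hker (n - 1 - m)
    have h2 := hsum (n - m) (by omega)
    rw [show n - 1 - (n - 1 - m) = n - (n - m) by omega,
      show K - 1 - (n - 1 - m) = K - (n - m) by omega, h2] at h1
    rw [show n - (n - m) = m by omega] at h1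
    exact psi_injective (h1.trans (map_zero _).symm)
  · rw [← sum_ad_wtPart_eq (k := 0) (by omega) (fun j hj => ?_), Finset.range_zero,
      Finset.sum_empty]
    rw [hyj, if_neg (by rw [Finset.mem_Ioc]; omega)]

end StateMaps

/-! ### Complements of the images, and symmetries -/

section Main

variable {F : Type*} [Field F] {a b p q : F} {r : ℕ} {G : MvPowerSeries (Fin 2) F}

/-- The exponents of the monomials of the normal form style: the ones of `x`, `x²`, `R`, `xR` and
of the powers `R^m`, `m ≥ 2`, except for `R^(r+1)` if the coefficient of `R^r` in the tail does not
vanish. -/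
def styleSet (r : ℕ) (G : MvPowerSeries (Fin 2) F) : Set (Fin 2 →₀ ℕ) :=
  {d | d = expo 1 0 ∨ d = expo 2 0 ∨ d = expo 0 1 ∨ d = expo 1 1 ∨
    ∃ m, 2 ≤ m ∧ d = expo 0 m ∧ ¬(m = r + 1 ∧ coeff (expo 0 r) G ≠ 0)}

theorem coeff_eq_zero_of_not_mem_styleSet (hr : 2 ≤ r) (hG : IsTail r G) {d : Fin 2 →₀ ℕ}
    (hd : d ∉ styleSet r G) : coeff d (lead a b p q + G) = 0 := by
  rw [← expo_eta d] at hd ⊢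
  generalize d 0 = l at hd ⊢
  generalize d 1 = m at hd ⊢
  simp only [styleSet, Set.mem_ofPred_eq, not_or, expo_inj] at hd
  obtain ⟨h1, h2, h3, h4, h5⟩ := hd
  have h5' : 2 ≤ m → l = 0 → m = r + 1 := by
    intro hm hl
    by_contra hne
    exact h5 ⟨m, hm, ⟨hl, rfl⟩, fun h => hne h.1⟩
  have hl6 : ¬(l = 0 ∧ m = 2) := fun h => by
    have := h5' (by omega) h.1
    omega
  rw [map_add, coeff_lead, if_neg h1, if_neg h2, if_neg h3, if_neg h4, if_neg hl6]
  simp only [add_zero, zero_add]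
  cases l with
  | succ l => exact hG.pure l m
  | zero =>
    rcases lt_or_ge m 2 with hm | hm
    · exact mem_ordGE_iff_expo.mp hG.mem 0 m (by omega)
    · rw [h5' hm rfl, hG.gap]

theorem lead_add_mem (hr : 2 ≤ r) (hG : IsTail r G) : lead a b p q + G ∈ ordGE F (Fin 2) 1 :=
  mem_ordGE_one_of_sub_linForm (lead_add_sub_mem hr hG.mem)

theorem wtPart_monomial (n l m : ℕ) (c : F) :
    wtPart n (monomial (expo l m) c) = if n = l + 2 * m then monomial (expo l m) c else 0 := by
  classical
  refine ext_expo fun i j => ?_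
  rw [coeff_wtPart_expo, coeff_monomial]
  by_cases h : expo i j = expo l m
  · rw [if_pos h]
    rw [expo_inj] at h
    by_cases hn : n = l + 2 * m
    · rw [if_pos (by omega), if_pos hn, h.1, h.2, coeff_monomial_same]
    · rw [if_neg (by omega), if_neg hn, map_zero]
  · rw [if_neg h, ite_self]
    split_ifs
    · rw [coeff_monomial, if_neg h]
    · rw [map_zero]

theorem ad_monomial (l m l' m' : ℕ) (c c' : F) :
    ad (monomial (expo l m) c) (monomial (expo l' m') c')
      = (c * c' * ((l' + m' : F) - (l + m))) • monomial (expo (l + l') (m + m')) 1 := by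
  have hm : ∀ (i j : ℕ) (e : F), monomial (expo i j) e = e • monomial (expo i j) (1 : F) :=
    fun i j e => by rw [← map_smul, smul_eq_mul, mul_one]
  have he : expo l m + expo l' m' = expo (l + l') (m + m') := by
    rw [← expo_eta (expo l m + expo l' m')]; simp
  have he' : expo l' m' + expo l m = expo (l + l') (m + m') := by rw [add_comm, he]
  rw [hm l m, hm l' m', ad_apply, Derivation.map_smul, Derivation.map_smul, eul_monomial,
    eul_monomial, degree_expo, degree_expo]
  simp only [smul_mul_smul_comm, monomial_mul_monomial, he, he', ← sub_smul, smul_smul, mul_one]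
  congr 1
  push_cast
  ring

/-- `R` already has grade two, so the grade-one part is `a x` alone, although the ordinary linear
part is `a x + b R`. -/
theorem wtPart_one_lead_add (hr : 2 ≤ r) (hG : IsTail r G) :
    wtPart 1 (lead a b p q + G) = monomial (expo 1 0) a := by
  classical
  refine ext_expo fun l m => ?_
  rw [coeff_wtPart_expo, coeff_monomial, map_add, coeff_lead]
  simp only [expo_inj]
  split_ifs <;> try omega
  · rw [mem_ordGE_iff_expo.mp hG.mem l m (by omega)]
    simp
  · rfl

theorem gradePart_mem_style (hr : 2 ≤ r) (hG : IsTail r G) {n : ℕ} (hn : 1 ≤ n) :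
    gradePart n (Theta + psi (lead a b p q + G))
      ∈ Submodule.span F (monoSet n (styleSet r G)) := by
  rw [gradePart_Theta_add_psi, if_neg (by omega), zero_add]
  refine mem_span_monoSet.mpr ⟨_, wtPart_raises n 1 _ (lead_add_mem hr hG), ?_, fun d hd => ?_,
    rfl⟩
  · rw [wtPart_wtPart, if_pos rfl]
  · rw [coeff_wtPart, coeff_eq_zero_of_not_mem_styleSet hr hG hd, ite_self]

theorem IsTail.eq_add (hG : IsTail r G) : G = monomial (expo 0 r) (coeff (expo 0 r) G)
    + coeffSeries fun l k => if l = 0 ∧ r + 2 ≤ k then coeff (expo 0 k) G else 0 := by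
  classical
  refine ext_expo fun l m => ?_
  rw [map_add, coeff_coeffSeries, coeff_monomial]
  simp only [expo_inj, expo_zero, expo_one]
  cases l with
  | succ l => rw [hG.pure, if_neg (by omega), if_neg (by omega), add_zero]
  | zero =>
    rw [zero_add]
    have hcases : m < r ∨ m = r ∨ m = r + 1 ∨ r + 2 ≤ m := by omega
    rcases hcases with h | rfl | rfl | h
    · rw [if_neg (by omega), if_neg (by omega), add_zero,
        mem_ordGE_iff_expo.mp hG.mem 0 m (by omega)]
    · rw [if_pos (by omega), if_neg (by omega), add_zero]
    · rw [if_neg (by omega), if_neg (by omega), add_zero, hG.gap]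
    · rw [if_neg (by omega), if_pos (by omega), zero_add]

theorem add_qE_add_qESum_eq (a b a' c e s : F) (r : ℕ) (γ : ℕ → ℕ → F) :
    Theta + a • qE F 1 1 + b • qE F 0 1 + a' • qE F 2 2 + c • qE F 1 2 + e • qE F 0 2
        + s • qE F 0 r + qESum γ
      = Theta + psi (monomial (expo 1 0) a + monomial (expo 0 1) b + monomial (expo 2 0) a'
        + monomial (expo 1 1) c + monomial (expo 0 2) e
        + (monomial (expo 0 r) s + coeffSeries γ)) := by
  have hm : ∀ (l k : ℕ) (t : F), t • qE F l k = psi (monomial (expo l (k - l)) t) :=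
    fun l k t => by rw [qE_eq_psi, ← map_smul, ← map_smul, smul_eq_mul, mul_one]
  simp only [hm, qESum_eq_psi, map_add, add_assoc, Nat.sub_self, Nat.sub_zero, Nat.reduceSub]

variable [CharZero F]

/-- The vector fields in the image of a state map have no terms of the normal form style. -/
theorem coeff_wtPart_ad_eq_zero (ha : a ≠ 0) (hr : 2 ≤ r) (hG : IsTail r G)
    {y : MvPowerSeries (Fin 2) F} (hy : y ∈ ordGE F (Fin 2) 1) {n : ℕ}
    (h : ∀ m < n, wtPart m (ad y (lead a b p q + G)) = 0) {d : Fin 2 →₀ ℕ}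
    (hd : d ∈ styleSet r G) : coeff d (wtPart n (ad y (lead a b p q + G))) = 0 := by
  rw [coeff_wtPart]
  split_ifs with hn
  swap
  · rfl
  have h3 := ad_mem_ordGE_three hy
    (lead_add_sub_mem (a := a) (b := b) (p := p) (q := q) hr hG.mem)
  rcases hd with rfl | rfl | rfl | rfl | ⟨m, hm, rfl, hnot⟩
  · exact h3 _ (by rw [degree_expo]; omega)
  · exact h3 _ (by rw [degree_expo]; omega)
  · exact h3 _ (by rw [degree_expo]; omega)
  · exact h3 _ (by rw [degree_expo]; omega)
  · by_contra hne
    refine hnot (eq_of_coeff_ad_ne_zero ha hr hG hy (fun e he hne' => ?_) hne)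
    rw [expo_zero, expo_one] at hn
    -- This links the two filtrations: among monomials of degree at most `m`, only `R^m` reaches
    -- grade `2m`. All others lie in lower grades, where the bracket vanishes, so `R^m` is its
    -- leading term by degree.
    have hlt : e 0 + 2 * e 1 < n := by
      rw [degree_fin_two] at he
      by_contra hge
      refine hne' ?_
      rw [← expo_eta e, expo_inj]
      omega
    have := congrArg (coeff e) (h _ hlt)
    rwa [coeff_wtPart, if_pos rfl, map_zero] at this

/-- Already the second level suffices: the bracket of `x^l R^m`, of grade `n - 1`, with the
grade-one part `a x` is `a (1 - l - m) x^(l+1) R^m`, and the factor is non-zero for `l + m ≥ 2`. -/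
theorem psi_monomial_mem_of_x_dvd (ha : a ≠ 0) (hr : 2 ≤ r) (hG : IsTail r G) {n k l m : ℕ}
    (hk : 2 ≤ min k n) (hn : l + 1 + 2 * m = n) (hlm : 2 ≤ l + m) :
    psi (monomial (expo (l + 1) m) 1) ∈ stateImage (Theta + psi (lead a b p q + G)) n k := by
  have hf := lead_add_mem (a := a) (b := b) (p := p) (q := q) hr hG
  have hsum : ∀ n', wtPart n' (ad (monomial (expo l m) (1 : F)) (lead a b p q + G))
      = if n - 1 ≤ n' then ad (monomial (expo l m) 1)
        (wtPart (n' - (n - 1)) (lead a b p q + G)) else 0 := by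
    intro n'
    rw [wtPart_ad]
    split_ifs with h
    · rw [Finset.sum_eq_single (n' - (n - 1))]
      · rw [wtPart_monomial, if_pos (by omega)]
      · intro i hi hne
        rw [Finset.mem_range] at hi
        rw [wtPart_monomial, if_neg (by omega), map_zero, LinearMap.zero_apply]
      · intro hi
        exact absurd (Finset.mem_range.mpr (by omega)) hi
    · refine Finset.sum_eq_zero fun i hi => ?_
      rw [Finset.mem_range] at hi
      rw [wtPart_monomial, if_neg (by omega), map_zero, LinearMap.zero_apply]
  have hmem := mem_stateImage_of_wtPart (f := lead a b p q + G) (n := n) (k := k)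
    (y := monomial (expo l m) (1 : F)) ?_ ?_ ?_
  · rw [hsum, if_pos (by omega), show n - (n - 1) = 1 by omega, wtPart_one_lead_add hr hG,
      ad_monomial, map_smul] at hmem
    refine (Submodule.smul_mem_iff _ ?_).mp hmem
    rw [one_mul]
    refine mul_ne_zero ha (sub_ne_zero.mpr ?_)
    exact_mod_cast (by omega : 1 + 0 ≠ l + m)
  · rw [mem_ordGE_one, coeff_monomial_ne]
    intro h
    have := congrArg Finsupp.degree h
    rw [degree_expo, map_zero] at this
    omega
  · intro j hj
    rw [wtPart_monomial, if_neg (by omega)]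
  · intro n' hn'
    rw [hsum]
    split_ifs with h
    · rw [show n' - (n - 1) = 0 by omega, wtPart_zero_of_mem hf, map_zero]
    · rfl

/-- The generator is `leadSym`, of lowest grade two with component `R`. It commutes with the leading
part, and the tail begins in grade `2r` with `b_r R^r`; the bracket therefore starts in grade `2r +
2` with `(r - 1) b_r R^(r+1)`. -/
theorem psi_monomial_mem_of_pow (hr : 2 ≤ r) (hG : IsTail r G)
    (hB : coeff (expo 0 r) G ≠ 0) {n k : ℕ} (hk : min k n = n) (hn : n = 2 * (r + 1)) :
    psi (monomial (expo 0 (r + 1)) 1) ∈ stateImage (Theta + psi (lead a b p q + G)) n k := by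
  classical
  have hW0 : ∀ j < 2, wtPart j (leadSym p q) = 0 := by
    intro j hj
    refine ext_expo fun l m => ?_
    rw [coeff_wtPart_expo, map_zero]
    split_ifs with h
    · rw [show m = 0 by omega, leadSym, coeff_X_one_mul_zero]
    · rfl
  have hW2 : wtPart 2 (leadSym p q) = monomial (expo 0 1) 1 := by
    refine ext_expo fun l m => ?_
    rw [coeff_wtPart_expo, coeff_monomial]
    simp only [expo_inj]
    rcases m with _ | m
    · rw [leadSym, coeff_X_one_mul_zero, ite_self, if_neg (by omega)]
    · rw [leadSym, coeff_X_one_mul_succ, map_add, coeff_linForm]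
      split_ifs <;> try omega
      · have : expo l m = 0 := by
          rw [show l = 0 by omega, show m = 0 by omega]; simp [expo]
        rw [this, coeff_zero_one]
        simp
      · rfl
  have hG0 : ∀ j < 2 * r, wtPart j G = 0 := by
    intro j hj
    refine ext_expo fun l m => ?_
    rw [coeff_wtPart_expo, map_zero]
    split_ifs with h
    · cases l with
      | zero => exact mem_ordGE_iff_expo.mp hG.mem 0 m (by omega)
      | succ l => exact hG.pure l m
    · rfl
  have hGr : wtPart (2 * r) G = monomial (expo 0 r) (coeff (expo 0 r) G) := by
    refine ext_expo fun l m => ?_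
    rw [coeff_wtPart_expo, coeff_monomial]
    simp only [expo_inj]
    cases l with
    | zero =>
      split_ifs with h1 h2 h2
      · rw [h2.2]
      · omega
      · omega
      · rfl
    | succ l => rw [hG.pure, ite_self, if_neg (by omega)]
  have had : ad (leadSym p q) (lead a b p q + G) = ad (leadSym p q) G := by
    rw [map_add, ad_leadSym_lead, zero_add]
  have hmem := mem_stateImage_of_wtPart (f := lead a b p q + G) (n := n) (k := k)
    (leadSym_mem p q) (fun j hj => hW0 j (by omega)) (fun m hm => by
      rw [had, wtPart_ad]
      refine Finset.sum_eq_zero fun i hi => ?_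
      rcases lt_or_ge i (2 * r) with h | h
      · rw [hG0 i h, map_zero]
      · rw [hW0 _ (by omega), map_zero, LinearMap.zero_apply])
  rw [had, wtPart_ad, Finset.sum_eq_single (2 * r)] at hmem
  · rw [show n - 2 * r = 2 by omega, hW2, hGr, ad_monomial, map_smul, zero_add,
      add_comm 1 r] at hmem
    refine (Submodule.smul_mem_iff _ ?_).mp hmem
    rw [one_mul]
    refine mul_ne_zero hB (sub_ne_zero.mpr ?_)
    exact_mod_cast (by omega : 0 + r ≠ 0 + 1)
  · intro i hi hne
    rw [Finset.mem_range] at hi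
    rcases lt_or_ge i (2 * r) with h | h
    · rw [hG0 i h, map_zero]
    · rw [hW0 _ (by omega), map_zero, LinearMap.zero_apply]
  · intro hi
    exact absurd (Finset.mem_range.mpr (by omega)) hi

/-- The images contain no style terms, and every monomial outside the style lies in them: multiples
of `x` by the second level, `R^(r+1)` by a state map of full depth `2r + 2`, which is the grade of
that monomial. Hence this level is already as good as the infinite one. -/
theorem isStyleComplement_simplest (ha : a ≠ 0) (hr : 2 ≤ r) (hG : IsTail r G) {n k : ℕ}
    (hn : 1 ≤ n) (hk : k = n ∨ k = 2 * r + 2) :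
    IsStyleComplement (Theta + psi (lead a b p q + G)) n k
      (Submodule.span F (monoSet n (styleSet r G))) := by
  have hk1 : 1 ≤ k := by omega
  have hle : stateImage (Theta + psi (lead a b p q + G)) n k ≤ gradeSpace F n := by
    intro W hW
    obtain ⟨y, hy, -, rfl⟩ := exists_of_mem_stateImage hn hk1 hW
    exact psi_wtPart_mem_gradeSpace
      (ordGE_anti (by omega) (ad_mem_ordGE hy (lead_add_mem hr hG)))
  refine ⟨⟨_, ?_, rfl⟩, ?_, le_antisymm (sup_le hle ?_) ?_⟩
  · rw [← monoSet_univ]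
    exact monoSet_mono n _
  · rw [Submodule.disjoint_def]
    intro W hW hW'
    obtain ⟨y, hy, hlow, rfl⟩ := exists_of_mem_stateImage hn hk1 hW
    obtain ⟨p', -, -, hp', he⟩ := mem_span_monoSet.mp hW'
    have he' := psi_injective he
    have : p' = 0 := by
      ext d
      rw [coeff_zero]
      by_cases hd : d ∈ styleSet r G
      · rw [← he', coeff_wtPart_ad_eq_zero ha hr hG hy hlow hd]
      · exact hp' d hd
    rw [he, this, map_zero]
  · rw [gradeSpace_eq]
    exact Submodule.span_mono (monoSet_mono n _)
  · rw [gradeSpace_eq, Submodule.span_le]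
    rintro v ⟨d, hd, hdn, -, rfl⟩
    by_cases hJ : d ∈ styleSet r G
    · exact Submodule.mem_sup_right (Submodule.subset_span ⟨d, hd, hdn, hJ, rfl⟩)
    · refine Submodule.mem_sup_left ?_
      rw [← expo_eta d] at hJ ⊢
      have hd0 : ¬(d 0 = 0 ∧ d 1 = 0) := fun h => hd (by
        rw [← expo_eta d, h.1, h.2]; simp [expo])
      generalize d 0 = l at hJ hdn hd0 ⊢
      generalize d 1 = m at hJ hdn hd0 ⊢
      simp only [styleSet, Set.mem_ofPred_eq, not_or, expo_inj] at hJ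
      obtain ⟨h1, h2, h3, h4, h5⟩ := hJ
      cases l with
      | zero =>
        have h6 : m = r + 1 ∧ coeff (expo 0 r) G ≠ 0 := by
          by_contra h6
          exact h5 ⟨m, by omega, ⟨rfl, rfl⟩, h6⟩
        obtain ⟨rfl, hB⟩ := h6
        exact psi_monomial_mem_of_pow hr hG hB (min_eq_right (by omega)) (by omega)
      | succ l =>
        exact psi_monomial_mem_of_x_dvd ha hr hG (le_min (by omega) (by omega)) hdn (by omega)

theorem isLevelNF_simplest (ha : a ≠ 0) (hr : 2 ≤ r) (hG : IsTail r G) :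
    IsLevelNF (Theta + psi (lead a b p q + G)) (2 * r + 2) := fun _ hn =>
  ⟨_, isStyleComplement_simplest ha hr hG hn (Or.inr rfl), gradePart_mem_style hr hG hn⟩

theorem isInfiniteNF_simplest (ha : a ≠ 0) (hr : 2 ≤ r) (hG : IsTail r G) :
    IsInfiniteNF (Theta + psi (lead a b p q + G)) := fun _ hn =>
  ⟨_, isStyleComplement_simplest ha hr hG hn (Or.inl rfl), gradePart_mem_style hr hG hn⟩

theorem noNontrivialSymmetry_simplest (ha : a ≠ 0) (hr : 2 ≤ r) (hG : IsTail r G)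
    (hB : coeff (expo 0 r) G ≠ 0) :
    NoNontrivialSymmetry (Theta + psi (lead a b p q + G)) := by
  refine ⟨fun S hS hbr => ?_, fun φ hφ htr => ?_⟩
  · obtain ⟨g, hg, rfl⟩ := mem_QE.mp hS
    rw [bracket_add_right, bracket_psi_Theta, zero_add, bracket_psi] at hbr
    obtain ⟨c, hc⟩ := eq_smul_of_ad_eq_zero ha hr hG hB hg
      (psi_injective (hbr.trans (map_zero _).symm))
    exact ⟨c, by rw [add_sub_cancel_left, ← map_smul, ← hc]⟩
  · obtain ⟨S, hS, rfl⟩ := hφ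
    obtain ⟨g, hg, rfl⟩ := mem_QE.mp hS
    -- An invariant field is fixed by `exp(ad g)`, hence commutes with the generator itself, which
    -- reduces to the infinitesimal case.
    have h0 := map_eq_zero_of_expMap_eq (ad_raises hg)
      ((transforms_timeOneFlow_iff hg).mp htr).symm
    obtain ⟨c, hc⟩ := eq_smul_of_ad_eq_zero ha hr hG hB hg h0
    exact ⟨c, by rw [add_sub_cancel_left, ← map_smul, ← hc]⟩

end Main

end HopfZero

end

/-! ### Assembly of the main theorem -/

open HopfZero in
theorem mainTheorem1 {F : Type*} [Field F] [CharZero F]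
    (β : ℕ → ℕ → F) (h00 : β 0 0 = 0) (h11 : β 1 1 ≠ 0) :
    ∃ (r : ℕ) (φ w : VF F) (b : F) (γ : ℕ → F),
      IsPermissible φ ∧ Transforms φ (Theta + qESum β) w ∧
      ((2 ≤ r ∧
          w = Theta + β 1 1 • qE F 1 1 + β 0 1 • qE F 0 1 + β 2 2 • qE F 2 2 + β 1 2 • qE F 1 2
            + b • qE F 0 r + qESum (fun l k => if l = 0 ∧ r + 2 ≤ k then γ k else 0)) ∨
        (2 < r ∧ specialCoeff β ≠ 0 ∧
          w = Theta + β 1 1 • qE F 1 1 + β 0 1 • qE F 0 1 + β 2 2 • qE F 2 2 + β 1 2 • qE F 1 2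
            + specialCoeff β • qE F 0 2
            + b • qE F 0 r + qESum (fun l k => if l = 0 ∧ r + 2 ≤ k then γ k else 0))) ∧
      (β 0 2 ≠ specialCoeff β → r = 2) ∧
      (β 0 2 = specialCoeff β → 2 < r ∧ (b = 0 → ∀ k, r + 2 ≤ k → γ k = 0)) ∧
      IsLevelNF w (2 * r + 2) ∧ IsInfiniteNF w ∧
      (b ≠ 0 → NoNontrivialSymmetry w) := by
  let a := β 1 1
  let b := β 0 1
  -- `p` and `q` solve `a p = β²₂` and `a q + b p = β¹₂`; then `b q` is the special coefficient.
  let p := β 2 2 / a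
  let q := (β 1 2 - b * p) / a
  have ha : a ≠ 0 := h11
  have hap : a * p = β 2 2 := mul_div_cancel₀ _ ha
  have haq : a * q + b * p = β 1 2 := by
    rw [mul_div_cancel₀ _ ha, sub_add_cancel]
  have hbq : b * q = specialCoeff β := by
    change β 0 1 * ((β 1 2 - β 0 1 * (β 2 2 / β 1 1)) / β 1 1) = _
    rw [specialCoeff]
    field_simp
  have hc : ∀ l m, MvPowerSeries.coeff (expo l m) (coeffSeries β) = β l (l + m) := fun l m => by
    rw [coeff_coeffSeries, expo_zero, expo_one]
  obtain ⟨r, G, hr, hG, hE, hr2, hr3, hG2⟩ := exists_flowEquiv_simplest (a := a) (b := b)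
    (p := p) (q := q) (f := coeffSeries β) ha ((hc 0 0).trans h00) (hc 1 0) (hc 0 1)
    ((hc 2 0).trans hap.symm) ((hc 1 1).trans haq.symm)
  rw [hc, zero_add, hbq] at hr2 hr3 hG2
  obtain ⟨φ, hφ, htr⟩ := hE.exists_transforms
  rw [← qESum_eq_psi] at htr
  let B := MvPowerSeries.coeff (expo 0 r) G
  let γ := fun k => MvPowerSeries.coeff (expo 0 k) G
  have hw : Theta + psi (lead a b p q + G) = Theta + β 1 1 • qE F 1 1 + β 0 1 • qE F 0 1
      + β 2 2 • qE F 2 2 + β 1 2 • qE F 1 2 + specialCoeff β • qE F 0 2 + B • qE F 0 r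
      + qESum (fun l k => if l = 0 ∧ r + 2 ≤ k then γ k else 0) := by
    rw [add_qE_add_qESum_eq, ← hG.eq_add, lead_eq, hap, haq, hbq]
  have hsym := noNontrivialSymmetry_simplest (a := a) (b := b) (p := p) (q := q) ha hr hG
  -- For `r = 2` the special term and the first tail term share the monomial `E⁰₂`, and their
  -- coefficients add up to `β⁰₂`.
  refine ⟨r, φ, _, if r = 2 then β 0 2 else B, γ, hφ, htr, ?_, hr2, fun h => ⟨hr3 h, fun h0 => ?_⟩,
    isLevelNF_simplest ha hr hG, isInfiniteNF_simplest ha hr hG, fun h0 => hsym ?_⟩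
  · rw [hw]
    rcases hr.eq_or_lt with h2 | h2
    · refine Or.inl ⟨hr, ?_⟩
      have hB : B = β 0 2 - specialCoeff β := by rw [← hG2]; simp only [B, ← h2]
      rw [if_pos h2.symm, add_assoc _ (specialCoeff β • _), ← h2, ← add_smul, hB,
        add_sub_cancel]
    · rw [if_neg h2.ne']
      by_cases hs : specialCoeff β = 0
      · refine Or.inl ⟨hr, ?_⟩
        rw [hs, zero_smul, add_zero]
      · exact Or.inr ⟨h2, hs, rfl⟩
  · rw [if_neg (hr3 h).ne'] at h0
    intro k _
    simp only [γ, hG.eq_zero h0, map_zero]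
  · split_ifs at h0 with h2
    -- For `r = 2`, the tail coefficient relevant to symmetries is `β⁰₂` minus the special
    -- coefficient, and it is non-zero because equality would force `r > 2`.
    · have hne : β 0 2 ≠ specialCoeff β := fun h => (hr3 h).ne' h2
      subst h2
      rw [hG2]
      exact sub_ne_zero.mpr hne
    · exact h0
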